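/- Let $\Omega=(-1,1)$, let $\|\cdot\|_0$ and $(\cdot,\cdot)$ be the norm and inner product of $L^2(\Omega)$ (real-valued functions), let $H^m(\Omega)$ be the space of functions whose generalized derivatives of orders $0,1,\dots,m$ lie in $L^2(\Omega)$, and let $|w|_m=\|w^{(m)}\|_0$, with $|w|_m=\infty$ if $w$ has no $m$-th generalized derivative in $L^2(\Omega)$. Let $\mathcal P_p$ be the space of polynomials of degree at most $p$ on $\Omega$, and for $w\in L^2(\Omega)$ let $\pi_p w\in\mathcal P_p$ be its $L^2$ projection, defined by $(\pi_p w-w,v)=0$ for all $v\in\mathcal P_p$. There is a constant $C>0$ such that for all positive integers $p,k,s,\nu$ with $p\ge 2k-1$, $p\ge\nu$ and $0<s<\min\{k,\,p-\nu\}$, and for all $w\in H^{k+s}(\Omega)$, $$|w-\pi_p w|_\nu^2\;\le\; C\,2^{2\nu-1}\,p^{2\nu-1}\,\frac{(p-s)!}{(p+s)!}\,|w|_{s+\nu}^2 .$$ In particular $C$ does not depend on $\nu$, $p$, $k$, $s$ or $w$. (For $\nu\le k$ the right-hand side is finite because $w\in H^{k+s}(\Omega)\subset H^{s+\nu}(\Omega)$.)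 -/

import Mathlib

open MeasureTheory Set
open scoped ENNReal ContDiff

namespace L2Projection

/-- The interval `Ω = (-1, 1)`. -/
def Omega : Set ℝ := Ioo (-1) 1

/-- Lebesgue measure on `Ω`. -/
noncomputable def muOmega : Measure ℝ := volume.restrict Omega

/-- `g` is the `m`-th generalized (weak) derivative of `f` on `Ω`: both are locally integrable on
`Ω`, and `∫ f φ^(m) = (-1)^m ∫ g φ` for every smooth `φ` with compact support in `Ω`. -/
def IsWeakDeriv (m : ℕ) (f g : ℝ → ℝ) : Prop :=
  LocallyIntegrableOn f Omega volume ∧ LocallyIntegrableOn g Omega volume ∧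
    ∀ φ : ℝ → ℝ, ContDiff ℝ ∞ φ → HasCompactSupport φ → tsupport φ ⊆ Omega →
      ∫ x in Omega, f x * iteratedDeriv m φ x = (-1) ^ m * ∫ x in Omega, g x * φ x

/-- `f ∈ H^m(Ω)`: the generalized derivatives of `f` of orders `0, 1, …, m` exist and lie
in `L²(Ω)`. -/
def MemH (m : ℕ) (f : ℝ → ℝ) : Prop :=
  MemLp f 2 muOmega ∧ ∀ j ≤ m, ∃ g : ℝ → ℝ, IsWeakDeriv j f g ∧ MemLp g 2 muOmega

/-- The seminorm `|f|_m = ‖f^(m)‖₀`, the `L²(Ω)` norm of the `m`-th generalized derivative. It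
is `∞` when `f` has no `m`-th generalized derivative in `L²(Ω)`. The infimum serves only to select
the generalized derivative, which is unique almost everywhere, see `semiH_eq`. -/
noncomputable def semiH (m : ℕ) (f : ℝ → ℝ) : ℝ≥0∞ :=
  ⨅ (g : ℝ → ℝ) (_ : IsWeakDeriv m f g), eLpNorm g 2 muOmega

theorem IsWeakDeriv.ae_unique {m : ℕ} {f g h : ℝ → ℝ} (hg : IsWeakDeriv m f g)
    (hh : IsWeakDeriv m f h) : g =ᵐ[muOmega] h := by
  have hO : IsOpen Omega := isOpen_Ioo
  have key := hO.ae_eq_zero_of_integral_contDiff_smul_eq_zero (μ := volume)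
    (f := fun x => g x - h x) (hg.2.1.sub hh.2.1) (by
      intro φ h1 h2 h3
      have e1 := hg.2.2 φ h1 h2 h3
      have e2 := hh.2.2 φ h1 h2 h3
      have e3 : ∫ x in Omega, g x * φ x = ∫ x in Omega, h x * φ x := by
        have hne : ((-1 : ℝ) ^ m) ≠ 0 := pow_ne_zero _ (by norm_num)
        exact mul_left_cancel₀ hne (e1.symm.trans e2)
      have hint : ∀ u : ℝ → ℝ, LocallyIntegrableOn u Omega volume →
          IntegrableOn (fun x => u x * φ x) Omega volume := by
        intro u hu
        have hK : IntegrableOn u (tsupport φ) volume :=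
          hu.integrableOn_compact_subset h3 h2
        have hK2 : IntegrableOn (fun x => u x * φ x) (tsupport φ) volume :=
          hK.mul_continuousOn h1.continuous.continuousOn h2
        have : Integrable (fun x => u x * φ x) volume := by
          refine (integrableOn_iff_integrable_of_support_subset ?_).1 hK2
          intro x hx
          apply subset_tsupport φ
          intro h0
          exact hx (by simp [h0])
        exact this.integrableOn
      have hsub : ∫ x in Omega, (g x - h x) * φ x = 0 := by
        simp_rw [sub_mul]
        rw [integral_sub (hint g hg.2.1) (hint h hh.2.1), e3, sub_self]
      rw [← hsub, setIntegral_eq_integral_of_forall_compl_eq_zero]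
      · exact integral_congr_ae (Filter.Eventually.of_forall fun x => by
          simp [mul_comm])
      · intro x hx
        have : φ x = 0 := by
          by_contra h0
          exact hx (h3 (subset_tsupport φ h0))
        simp [this])
  rw [muOmega, Filter.EventuallyEq, ae_restrict_iff' hO.measurableSet]
  filter_upwards [key] with x hx hxO
  exact sub_eq_zero.1 (hx hxO)

theorem semiH_eq {m : ℕ} {f g : ℝ → ℝ} (hg : IsWeakDeriv m f g) :
    semiH m f = eLpNorm g 2 muOmega := by
  refine le_antisymm (iInf₂_le g hg) (le_iInf₂ fun h hh => ?_)
  exact (eLpNorm_congr_ae (hg.ae_unique hh)).le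

/-- `q` is the `L²(Ω)` projection of `w` onto the polynomials of degree at most `p`:
`q ∈ P_p`, and `(q - w, v) = 0` for all `v ∈ P_p`. -/
def IsL2Proj (p : ℕ) (w : ℝ → ℝ) (q : Polynomial ℝ) : Prop :=
  q ∈ Polynomial.degreeLE ℝ p ∧
    ∀ v ∈ Polynomial.degreeLE ℝ p, ∫ x in Omega, (q.eval x - w x) * v.eval x = 0

theorem memLp_poly (q : Polynomial ℝ) : MemLp (fun x => q.eval x) 2 muOmega := by
  obtain ⟨C, hC⟩ := (isCompact_Icc (a := (-1 : ℝ)) (b := 1)).exists_bound_of_continuousOn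
    q.continuous.continuousOn
  have : IsFiniteMeasure muOmega := ⟨by simp [muOmega, Omega]⟩
  refine MemLp.of_bound q.continuous.aestronglyMeasurable C ?_
  rw [muOmega, ae_restrict_iff' (show MeasurableSet Omega from measurableSet_Ioo)]
  exact Filter.Eventually.of_forall fun x hx => hC x (Ioo_subset_Icc_self hx)

theorem integrable_mul_poly {w : ℝ → ℝ} (hw : MemLp w 2 muOmega) (v : Polynomial ℝ) :
    Integrable (fun x => w x * v.eval x) muOmega :=
  hw.integrable_mul (memLp_poly v)

theorem poly_eq_zero_of_integral {q : Polynomial ℝ}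
    (h : ∫ x in Omega, q.eval x * q.eval x = 0) : q = 0 := by
  have hint : Integrable (fun x => q.eval x * q.eval x) muOmega :=
    integrable_mul_poly (memLp_poly q) q
  have h0 := (integral_eq_zero_iff_of_nonneg (fun x => mul_self_nonneg _) hint).1 h
  by_contra hq
  have hfin : (q.rootSet ℝ).Finite := q.rootSet_finite ℝ
  have hsub : ∀ᵐ x ∂muOmega, x ∈ q.rootSet ℝ := by
    filter_upwards [h0] with x hx
    rw [Polynomial.mem_rootSet]
    exact ⟨hq, by simpa using hx⟩
  have hnull : ∀ᵐ x ∂muOmega, x ∉ q.rootSet ℝ :=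
    measure_eq_zero_iff_ae_notMem.1
      (Measure.absolutelyContinuous_of_le Measure.restrict_le_self
        (hfin.measure_zero volume))
  have hbot : ∀ᵐ x ∂muOmega, False := by
    filter_upwards [hsub, hnull] with x h1 h2 using h2 h1
  have : muOmega univ = 0 := by simpa [ae_iff] using hbot
  simp [muOmega, Omega] at this
  norm_num at this

/-- Every `w ∈ L²(Ω)` has an `L²` projection onto `P_p`. -/
theorem exists_isL2Proj (p : ℕ) {w : ℝ → ℝ} (hw : MemLp w 2 muOmega) :
    ∃ q, IsL2Proj p w q := by
  have : FiniteDimensional ℝ (Polynomial.degreeLE ℝ (p : WithBot ℕ)) := by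
    have : Polynomial.degreeLE ℝ (p : WithBot ℕ) = Polynomial.degreeLT ℝ (p + 1) := by
      ext q
      rw [Polynomial.mem_degreeLE, Polynomial.mem_degreeLT, Polynomial.degree_le_iff_coeff_zero,
        Polynomial.degree_lt_iff_coeff_zero]
      exact ⟨fun h m hm => h m (by exact_mod_cast hm), fun h m hm => h m (by exact_mod_cast hm)⟩
    rw [this]
    exact Module.Finite.equiv (Polynomial.degreeLTEquiv ℝ (p + 1)).symm
  let V := Polynomial.degreeLE ℝ (p : WithBot ℕ)
  let F : (u : ℝ → ℝ) → MemLp u 2 muOmega → Module.Dual ℝ V := fun u hu =>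
    { toFun := fun v => ∫ x, u x * (v : Polynomial ℝ).eval x ∂muOmega
      map_add' := fun a b => by
        rw [← integral_add (integrable_mul_poly hu a) (integrable_mul_poly hu b)]
        simp [mul_add]
      map_smul' := fun c a => by
        rw [RingHom.id_apply, smul_eq_mul, ← integral_const_mul]
        simp [mul_left_comm] }
  let B : V →ₗ[ℝ] Module.Dual ℝ V :=
    { toFun := fun q => F (fun x => (q : Polynomial ℝ).eval x) (memLp_poly q)
      map_add' := fun a b => by
        ext v
        change ∫ x, ((a + b : V) : Polynomial ℝ).eval x * (v : Polynomial ℝ).eval x ∂muOmega =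
          (∫ x, (a : Polynomial ℝ).eval x * (v : Polynomial ℝ).eval x ∂muOmega) +
            ∫ x, (b : Polynomial ℝ).eval x * (v : Polynomial ℝ).eval x ∂muOmega
        rw [← integral_add (integrable_mul_poly (memLp_poly a) v)
          (integrable_mul_poly (memLp_poly b) v)]
        simp [add_mul]
      map_smul' := fun c a => by
        ext v
        change ∫ x, ((c • a : V) : Polynomial ℝ).eval x * (v : Polynomial ℝ).eval x ∂muOmega =
          c * ∫ x, (a : Polynomial ℝ).eval x * (v : Polynomial ℝ).eval x ∂muOmega
        rw [← integral_const_mul]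
        simp [mul_assoc] }
  have hinj : Function.Injective B := by
    rw [injective_iff_map_eq_zero]
    intro q hq
    have h1 : B q q = 0 := by rw [hq]; rfl
    exact Subtype.ext (poly_eq_zero_of_integral h1)
  have hsurj : Function.Surjective B :=
    (LinearMap.injective_iff_surjective_of_finrank_eq_finrank
      (Subspace.dual_finrank_eq (K := ℝ) (V := V)).symm).1 hinj
  obtain ⟨q, hq⟩ := hsurj (F w hw)
  refine ⟨q, q.2, fun v hv => ?_⟩
  have h1 : (∫ x, (q : Polynomial ℝ).eval x * v.eval x ∂muOmega) = ∫ x, w x * v.eval x ∂muOmega :=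
    LinearMap.congr_fun hq ⟨v, hv⟩
  simp_rw [sub_mul]
  change ∫ x, ((q : Polynomial ℝ).eval x * v.eval x - w x * v.eval x) ∂muOmega = 0
  rw [integral_sub (integrable_mul_poly (memLp_poly _) v) (integrable_mul_poly hw v), h1, sub_self]

theorem IsL2Proj.unique {p : ℕ} {w : ℝ → ℝ} (hw : MemLp w 2 muOmega) {q r : Polynomial ℝ}
    (hq : IsL2Proj p w q) (hr : IsL2Proj p w r) : q = r := by
  have hmem : q - r ∈ Polynomial.degreeLE ℝ p := Submodule.sub_mem _ hq.1 hr.1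
  have h1 := hq.2 _ hmem
  have h2 := hr.2 _ hmem
  refine sub_eq_zero.1 (poly_eq_zero_of_integral ?_)
  have i1 : Integrable (fun x => (q.eval x - w x) * (q - r).eval x) muOmega :=
    integrable_mul_poly ((memLp_poly q).sub hw) _
  have i2 : Integrable (fun x => (r.eval x - w x) * (q - r).eval x) muOmega :=
    integrable_mul_poly ((memLp_poly r).sub hw) _
  have h3 := integral_sub i1 i2
  rw [show (∫ x, (q.eval x - w x) * (q - r).eval x ∂muOmega) = 0 from h1,
    show (∫ x, (r.eval x - w x) * (q - r).eval x ∂muOmega) = 0 from h2, sub_zero] at h3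
  rw [← h3, muOmega]
  congr 1
  ext x
  simp only [Polynomial.eval_sub]
  ring

open Classical in
/-- The `L²(Ω)` projection `π_p w ∈ P_p` of `w ∈ L²(Ω)` (and `0` if there is none). -/
noncomputable def l2Proj (p : ℕ) (w : ℝ → ℝ) : Polynomial ℝ :=
  if h : ∃ q, IsL2Proj p w q then h.choose else 0

theorem l2Proj_spec (p : ℕ) {w : ℝ → ℝ} (hw : MemLp w 2 muOmega) :
    IsL2Proj p w (l2Proj p w) := by
  have h := exists_isL2Proj p hw
  rw [l2Proj, dif_pos h]
  exact h.choose_spec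

end L2Projection

/-!
The projection of `w` is the partial sum `S_p w` of its Legendre expansion. Write `β_m = (w', L_m)`.
From `L_{m+1}' - L_{m-1}' = (2m + 1) L_m` one gets
`(S_p w)' = S_{p-1} w' - ½ (β_p L_{p-1}' + β_{p+1} L_p')` (`IsPrimitive.derivative_legendreSum`).
Iterating `ν` times, the derivative of order `ν` of `w - S_p w` becomes the truncation error of
`w^(ν)` in `L²(Ω)` plus `ν` commutators, each consisting of a Legendre coefficient of a derivative
of `w` times a derivative of a Legendre polynomial.

* The Legendre coefficients of a function with `τ` derivatives are controlled by Bessel's inequality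
  for the functions `L_m^(τ)`, which are orthogonal with respect to the weight `(1 - x²)^τ`
  (`SobolevChain.bessel`). Together with Weierstrass' theorem this also bounds the truncation error
  in `L²(Ω)` by `(p - s)! / (p + s)!` (`SobolevChain.integral_sub_legendreSum_sq_le`).
* `‖L_n^(ν)‖² ≤ 2 L_n^(ν-1)(1) L_n^(ν)(1)` by integration by parts, and the values at `1` are explicit
  products (`integral_iterate_derivative_legendre_sq_le`, `eval_one_iterate_derivative_legendre`).

Hence the square of a commutator is at most the explicit number `commutatorBound`, which is largest
for the commutator of highest order and at most
`4^(1-ν) (2p)^(2ν-1) (p - s)! / (p + s)!` (`commutatorBound_le_succ`,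
`four_pow_mul_commutatorBound_le`). Adding the `ν + 1` contributions costs `(ν + 1)² ≤ 4^ν`, so that
`C = 4` works.

The integrations by parts need classical derivatives. They are available since a function with a weak
derivative of order `M` in `L²(Ω)` is almost everywhere an `M`-fold indefinite integral plus a
polynomial (`IsWeakDeriv.exists_sobolevChain`), by the lemma of du Bois-Reymond of order `M`.
-/

open Polynomial

namespace L2Projection

/-! ### Legendre polynomials -/

/-- The Legendre polynomials, by Bonnet's recurrence. -/
noncomputable def legendre : ℕ → ℝ[X]
  | 0 => 1
  | 1 => X
  | n + 2 => C (1 / (n + 2 : ℝ)) *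
      (C (2 * n + 3 : ℝ) * (X * legendre (n + 1)) - C (n + 1 : ℝ) * legendre n)

theorem legendre_zero : legendre 0 = 1 := by rw [legendre]

theorem legendre_one : legendre 1 = X := by rw [legendre]

theorem legendre_recurrence (n : ℕ) :
    C (n + 2 : ℝ) * legendre (n + 2) =
      C (2 * n + 3 : ℝ) * (X * legendre (n + 1)) - C (n + 1 : ℝ) * legendre n := by
  have h : (n + 2 : ℝ) ≠ 0 := by positivity
  rw [legendre, ← mul_assoc, ← C_mul, mul_one_div_cancel h, C_1, one_mul]

/-- The identities `L_{n+1}' = x L_n' + (n + 1) L_n` and `x L_{n+1}' = L_n' + (n + 1) L_{n+1}`, which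
follow from Bonnet's recurrence only together. -/
theorem derivative_legendre_aux (n : ℕ) :
    derivative (legendre (n + 1)) =
        X * derivative (legendre n) + C (n + 1 : ℝ) * legendre n ∧
      X * derivative (legendre (n + 1)) =
        derivative (legendre n) + C (n + 1 : ℝ) * legendre (n + 1) := by
  induction n with
  | zero => simp [legendre_zero, legendre_one]
  | succ n ih =>
    obtain ⟨hA, hB⟩ := ih
    have hn : (C (n + 2 : ℝ) : ℝ[X]) ≠ 0 := C_ne_zero.2 (by positivity)
    have hr := legendre_recurrence n
    have hd := congrArg derivative hr
    simp only [derivative_mul, derivative_C, derivative_X, derivative_sub, zero_mul, zero_add,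
      one_mul] at hd
    have hA' : derivative (legendre (n + 2)) =
        X * derivative (legendre (n + 1)) + C (n + 2 : ℝ) * legendre (n + 1) := by
      apply mul_left_cancel₀ hn
      rw [hd]
      simp only [map_add, map_mul, map_natCast, map_ofNat, map_one] at hB ⊢
      linear_combination (n + 1 : ℝ[X]) * hB
    constructor
    · rw [show n + 1 + 1 = n + 2 from rfl, hA']
      push_cast
      ring_nf
    · rw [show n + 1 + 1 = n + 2 from rfl, hA']
      simp only [map_add, map_mul, map_natCast, map_ofNat, map_one, Nat.cast_add, Nat.cast_one]
        at hA hB hr ⊢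
      linear_combination X * hB - hA - hr

theorem derivative_legendre_succ (n : ℕ) :
    derivative (legendre (n + 1)) = X * derivative (legendre n) + C (n + 1 : ℝ) * legendre n :=
  (derivative_legendre_aux n).1

theorem X_mul_derivative_legendre_succ (n : ℕ) :
    X * derivative (legendre (n + 1)) =
      derivative (legendre n) + C (n + 1 : ℝ) * legendre (n + 1) :=
  (derivative_legendre_aux n).2

theorem derivative_legendre_add_two (n : ℕ) :
    derivative (legendre (n + 2)) =
      derivative (legendre n) + C (2 * n + 3 : ℝ) * legendre (n + 1) := by
  have h1 := derivative_legendre_succ (n + 1)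
  have h2 := X_mul_derivative_legendre_succ n
  rw [show n + 1 + 1 = n + 2 from rfl] at h1
  simp only [map_add, map_mul, map_natCast, map_ofNat, map_one, Nat.cast_add, Nat.cast_one]
    at h1 h2 ⊢
  linear_combination h1 + h2

/-- Legendre's differential equation. -/
theorem legendre_ode (n : ℕ) :
    derivative ((1 - X ^ 2) * derivative (legendre n)) = -C (n * (n + 1) : ℝ) * legendre n := by
  cases n with
  | zero => simp [legendre_zero]
  | succ n =>
    have hA := derivative_legendre_succ n
    have hB := X_mul_derivative_legendre_succ n
    have e : (1 - X ^ 2) * derivative (legendre (n + 1)) =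
        C (n + 1 : ℝ) * (legendre n - X * legendre (n + 1)) := by
      simp only [map_add, map_natCast, map_one] at hA hB ⊢
      linear_combination hA - X * hB
    rw [e]
    simp only [derivative_mul, derivative_C, derivative_X, derivative_sub, zero_mul, zero_add,
      one_mul]
    simp only [map_add, map_mul, map_natCast, map_one, Nat.cast_add, Nat.cast_one] at hA hB ⊢
    linear_combination -(n + 1 : ℝ[X]) * hB

theorem eval_one_legendre (n : ℕ) : (legendre n).eval 1 = 1 := by
  induction n using Nat.twoStepInduction with
  | zero => simp [legendre_zero]
  | one => simp [legendre_one]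
  | more n h0 h1 =>
    have h := congrArg (eval 1) (legendre_recurrence n)
    simp only [eval_mul, eval_C, eval_sub, eval_X, h0, h1] at h
    have hn : (n + 2 : ℝ) ≠ 0 := by positivity
    apply mul_left_cancel₀ hn
    rw [h]; ring

theorem eval_neg_one_legendre (n : ℕ) : (legendre n).eval (-1) = (-1) ^ n := by
  induction n using Nat.twoStepInduction with
  | zero => simp [legendre_zero]
  | one => simp [legendre_one]
  | more n h0 h1 =>
    have h := congrArg (eval (-1)) (legendre_recurrence n)
    simp only [eval_mul, eval_C, eval_sub, eval_X, h0, h1] at h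
    have hn : (n + 2 : ℝ) ≠ 0 := by positivity
    apply mul_left_cancel₀ hn
    rw [h]; ring

theorem natDegree_legendre_le (n : ℕ) : (legendre n).natDegree ≤ n := by
  induction n using Nat.twoStepInduction with
  | zero => simp [legendre_zero]
  | one => simp [legendre_one]
  | more n h0 h1 =>
    rw [legendre]
    refine (natDegree_C_mul_le _ _).trans ((natDegree_sub_le _ _).trans (max_le ?_ ?_))
    · refine (natDegree_C_mul_le _ _).trans (natDegree_mul_le.trans ?_)
      rw [natDegree_X]; omega
    · exact (natDegree_C_mul_le _ _).trans (by omega)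

theorem coeff_legendre_pos (n : ℕ) : 0 < (legendre n).coeff n := by
  induction n with
  | zero => simp [legendre_zero]
  | succ n ih =>
    cases n with
    | zero => simp [legendre_one]
    | succ n =>
      have h0 : (legendre n).coeff (n + 2) = 0 :=
        coeff_eq_zero_of_natDegree_lt ((natDegree_legendre_le n).trans_lt (by omega))
      rw [show n + 1 + 1 = n + 2 from rfl, legendre, coeff_C_mul, coeff_sub, coeff_C_mul,
        coeff_C_mul, show n + 2 = (n + 1) + 1 from rfl, coeff_X_mul,
        show (n + 1) + 1 = n + 2 from rfl, h0]
      have : 0 < (2 * n + 3 : ℝ) := by positivity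
      rw [mul_zero, sub_zero]
      positivity

theorem degree_legendre (n : ℕ) : (legendre n).degree = n :=
  degree_eq_of_le_of_coeff_ne_zero
    (natDegree_le_iff_degree_le.1 (natDegree_legendre_le n)) (coeff_legendre_pos n).ne'

theorem span_legendre_degreeLE (n : ℕ) :
    Submodule.span ℝ (legendre '' Iic n) = degreeLE ℝ n := by
  let S : Polynomial.Sequence ℝ := ⟨legendre, degree_legendre⟩
  exact S.span_degreeLE fun i _ => (leadingCoeff_ne_zero.2 (S.ne_zero i)).isUnit

theorem span_legendre_degreeLT (n : ℕ) :
    Submodule.span ℝ (legendre '' Iio n) = degreeLT ℝ n := by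
  let S : Polynomial.Sequence ℝ := ⟨legendre, degree_legendre⟩
  exact S.span_degreeLT fun i _ => (leadingCoeff_ne_zero.2 (S.ne_zero i)).isUnit



/-! ### Derivatives of Legendre polynomials -/

/-- The differential equation of `L_n^(j)`: the `j`-th derivative of Legendre's equation. -/
theorem iterate_derivative_legendre_ode (n j : ℕ) :
    (1 - X ^ 2) * derivative^[j + 2] (legendre n) -
        C (2 * (j + 1) : ℝ) * (X * derivative^[j + 1] (legendre n)) +
      C ((n - j) * (n + j + 1) : ℝ) * derivative^[j] (legendre n) = 0 := by
  induction j with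
  | zero =>
    have h := legendre_ode n
    simp only [derivative_mul, derivative_sub, derivative_one, derivative_X_pow] at h
    simp only [Function.iterate_succ_apply', Function.iterate_zero, id]
    simp only [map_add, map_mul, map_natCast, map_ofNat, map_one, map_sub, Nat.cast_zero,
      Nat.cast_ofNat, map_zero] at h ⊢
    linear_combination h
  | succ j ih =>
    have h := congrArg derivative ih
    simp only [derivative_mul, derivative_sub, derivative_add, derivative_one, derivative_X_pow,
      derivative_C, derivative_X, derivative_zero,
      ← Function.iterate_succ_apply' derivative] at h
    simp only [map_add, map_mul, map_natCast, map_ofNat, map_one, map_sub, Nat.cast_add,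
      Nat.cast_ofNat, Nat.cast_one, Nat.succ_eq_add_one] at h ⊢
    linear_combination h

/-- The Sturm-Liouville form of the equation of `L_n^(j)`. -/
theorem derivative_weight_mul_iterate_derivative_legendre (n j : ℕ) :
    derivative ((1 - X ^ 2) ^ (j + 1) * derivative^[j + 1] (legendre n)) =
      -C ((n - j) * (n + j + 1) : ℝ) * ((1 - X ^ 2) ^ j * derivative^[j] (legendre n)) := by
  have h := iterate_derivative_legendre_ode n j
  rw [derivative_mul, derivative_pow, ← Function.iterate_succ_apply' derivative]
  simp only [derivative_sub, derivative_one, derivative_X_pow]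
  simp only [map_add, map_mul, map_natCast, map_ofNat, map_one, map_sub, Nat.cast_add,
      Nat.cast_ofNat, Nat.cast_one, Nat.succ_eq_add_one, Nat.add_sub_cancel] at h ⊢
  linear_combination (1 - X ^ 2) ^ j * h

theorem iterate_derivative_legendre_eval_one_succ (n j : ℕ) :
    (derivative^[j + 1] (legendre n)).eval 1 =
      (n - j) * (n + j + 1) / (2 * (j + 1)) * (derivative^[j] (legendre n)).eval 1 := by
  have h := congrArg (eval 1) (iterate_derivative_legendre_ode n j)
  simp only [eval_add, eval_sub, eval_mul, eval_C, eval_X, eval_pow, eval_one, eval_zero] at h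
  have : (j + 1 : ℝ) ≠ 0 := by positivity
  field_simp
  linear_combination -h

theorem iterate_derivative_legendre_eval_neg_one_succ (n j : ℕ) :
    (derivative^[j + 1] (legendre n)).eval (-1) =
      -((n - j) * (n + j + 1) / (2 * (j + 1))) * (derivative^[j] (legendre n)).eval (-1) := by
  have h := congrArg (eval (-1)) (iterate_derivative_legendre_ode n j)
  simp only [eval_add, eval_sub, eval_mul, eval_C, eval_X, eval_pow, eval_one, eval_zero] at h
  have : (j + 1 : ℝ) ≠ 0 := by positivity
  field_simp
  linear_combination h

/-- `L_n^(j)(1)`, see `eval_one_iterate_derivative_legendre`. -/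
noncomputable def endVal (n j : ℕ) : ℝ :=
  ∏ i ∈ Finset.range j, ((n - i) * (n + i + 1) / (2 * (i + 1)) : ℝ)

theorem endVal_succ (n j : ℕ) :
    endVal n (j + 1) = endVal n j * ((n - j) * (n + j + 1) / (2 * (j + 1))) := by
  rw [endVal, Finset.prod_range_succ, endVal]

theorem eval_one_iterate_derivative_legendre (n j : ℕ) :
    (derivative^[j] (legendre n)).eval 1 = endVal n j := by
  induction j with
  | zero => simp [endVal, eval_one_legendre]
  | succ j ih => rw [iterate_derivative_legendre_eval_one_succ, ih, endVal_succ, mul_comm]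

theorem eval_neg_one_iterate_derivative_legendre (n j : ℕ) :
    (derivative^[j] (legendre n)).eval (-1) = (-1) ^ (n + j) * endVal n j := by
  induction j with
  | zero => simp [endVal, eval_neg_one_legendre]
  | succ j ih =>
    rw [iterate_derivative_legendre_eval_neg_one_succ, ih, endVal_succ]
    ring

theorem endVal_pos {n j : ℕ} (h : j ≤ n) : 0 < endVal n j := by
  refine Finset.prod_pos fun i hi => ?_
  have : (i + 1 : ℝ) ≤ n := by exact_mod_cast (Finset.mem_range.1 hi).trans_le h
  have : 0 < (n - i : ℝ) := by linarith
  positivity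

theorem endVal_le_succ {n j : ℕ} (h : j ≤ n + 1) : endVal n j ≤ endVal (n + 1) j := by
  refine Finset.prod_le_prod (fun i hi => ?_) fun i hi => ?_
  all_goals
    have : (i + 1 : ℝ) ≤ n + 1 := by exact_mod_cast (Finset.mem_range.1 hi).trans_le h
    have : 0 ≤ (n - i : ℝ) := by linarith
  · positivity
  · push_cast
    gcongr <;> linarith

theorem endVal_succ_succ (n j : ℕ) :
    endVal (n + 1) (j + 1) =
      endVal n j * ((n + j + 2) * (n + j + 1) / (2 * (j + 1))) := by
  induction j with
  | zero => simp [endVal]; ring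
  | succ j ih =>
    rw [endVal_succ, ih, endVal_succ]
    push_cast
    field_simp
    ring

/-- The polynomials that are nonnegative combinations of Legendre polynomials, as a submodule over
the semiring of nonnegative reals. -/
noncomputable def legendreCone : Submodule NNReal ℝ[X] :=
  Submodule.span NNReal (range legendre)

theorem legendre_mem_cone (n : ℕ) : legendre n ∈ legendreCone :=
  Submodule.subset_span ⟨n, rfl⟩

theorem C_mul_mem_cone {c : ℝ} (hc : 0 ≤ c) {q : ℝ[X]} (hq : q ∈ legendreCone) :
    C c * q ∈ legendreCone := by
  rw [← smul_eq_C_mul]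
  exact legendreCone.smul_mem (⟨c, hc⟩ : NNReal) hq

theorem derivative_legendre_mem_cone (n : ℕ) : derivative (legendre n) ∈ legendreCone := by
  induction n using Nat.twoStepInduction with
  | zero => simp [legendre_zero]
  | one =>
    rw [legendre_one, derivative_X, ← legendre_zero]
    exact legendre_mem_cone 0
  | more n h0 h1 =>
    rw [derivative_legendre_add_two]
    exact add_mem h0 (C_mul_mem_cone (by positivity) (legendre_mem_cone _))

theorem derivative_mem_cone {q : ℝ[X]} (hq : q ∈ legendreCone) :
    derivative q ∈ legendreCone := by
  induction hq using Submodule.span_induction with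
  | mem x hx => obtain ⟨n, rfl⟩ := hx; exact derivative_legendre_mem_cone n
  | zero => simp
  | add x y _ _ hx hy => rw [derivative_add]; exact add_mem hx hy
  | smul c x _ hx =>
    rw [NNReal.smul_def, derivative_smul, ← NNReal.smul_def]
    exact legendreCone.smul_mem _ hx

theorem iterate_derivative_legendre_mem_cone (n j : ℕ) :
    derivative^[j] (legendre n) ∈ legendreCone := by
  induction j with
  | zero => exact legendre_mem_cone n
  | succ j ih => rw [Function.iterate_succ_apply']; exact derivative_mem_cone ih

/-! ### Integration by parts on the interval -/

instance : IsFiniteMeasure muOmega := ⟨by simp [muOmega, Omega]⟩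

theorem integral_muOmega (f : ℝ → ℝ) : ∫ x, f x ∂muOmega = ∫ x in (-1)..1, f x := by
  rw [intervalIntegral.integral_of_le (by norm_num), integral_Ioc_eq_integral_Ioo, muOmega, Omega]

theorem integrable_muOmega_iff {f : ℝ → ℝ} :
    Integrable f muOmega ↔ IntervalIntegrable f volume (-1) 1 :=
  (intervalIntegrable_iff_integrableOn_Ioo_of_le (by norm_num)).symm

theorem memLp_of_continuousOn {u : ℝ → ℝ} (hu : ContinuousOn u (Icc (-1) 1)) :
    MemLp u 2 muOmega := by
  obtain ⟨C, hC⟩ := isCompact_Icc.exists_bound_of_continuousOn hu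
  refine MemLp.of_bound ((hu.mono Ioo_subset_Icc_self).aestronglyMeasurable measurableSet_Ioo) C ?_
  rw [muOmega, ae_restrict_iff' (show MeasurableSet Omega from measurableSet_Ioo)]
  exact Filter.Eventually.of_forall fun x hx => hC x (Ioo_subset_Icc_self hx)

/-- `u` is on `[-1, 1]` an indefinite integral of the integrable function `v`. -/
def IsPrimitive (u v : ℝ → ℝ) : Prop :=
  IntervalIntegrable v volume (-1) 1 ∧ ∀ x ∈ Icc (-1 : ℝ) 1, u x = u (-1) + ∫ t in (-1)..x, v t

theorem IsPrimitive.continuousOn {u v : ℝ → ℝ} (h : IsPrimitive u v) :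
    ContinuousOn u (Icc (-1) 1) := by
  have h1 := intervalIntegral.continuousOn_primitive_interval' h.1 (left_mem_uIcc)
  rw [uIcc_of_le (by norm_num)] at h1
  exact (continuousOn_const.add h1).congr h.2

theorem IsPrimitive.memLp {u v : ℝ → ℝ} (h : IsPrimitive u v) : MemLp u 2 muOmega :=
  memLp_of_continuousOn h.continuousOn

theorem isPrimitive_of_hasDerivAt {u v : ℝ → ℝ} (h : ∀ x, HasDerivAt u (v x) x)
    (hv : Continuous v) : IsPrimitive u v := by
  refine ⟨hv.intervalIntegrable _ _, fun x _ => ?_⟩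
  rw [intervalIntegral.integral_eq_sub_of_hasDerivAt (fun t _ => h t) (hv.intervalIntegrable _ _)]
  ring

theorem isPrimitive_poly (q : ℝ[X]) :
    IsPrimitive (fun x => q.eval x) (fun x => (derivative q).eval x) :=
  isPrimitive_of_hasDerivAt (fun x => q.hasDerivAt x) (derivative q).continuous

theorem IsPrimitive.add {u v u' v' : ℝ → ℝ} (h : IsPrimitive u v) (h' : IsPrimitive u' v') :
    IsPrimitive (fun x => u x + u' x) (fun x => v x + v' x) := by
  refine ⟨h.1.add h'.1, fun x hx => ?_⟩
  have hs : uIcc (-1) x ⊆ uIcc (-1 : ℝ) 1 := by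
    rw [uIcc_of_le hx.1, uIcc_of_le (by norm_num)]; exact Icc_subset_Icc_right hx.2
  rw [intervalIntegral.integral_add (h.1.mono_set hs) (h'.1.mono_set hs)]
  linear_combination h.2 x hx + h'.2 x hx

/-- Integration by parts. -/
theorem IsPrimitive.integral_mul {u v φ ψ : ℝ → ℝ} (h : IsPrimitive u v)
    (h' : IsPrimitive φ ψ) :
    ∫ x, v x * φ x ∂muOmega = u 1 * φ 1 - u (-1) * φ (-1) - ∫ x, u x * ψ x ∂muOmega := by
  have key : ∀ {u v : ℝ → ℝ}, IsPrimitive u v → ∃ U : ℝ → ℝ,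
      AbsolutelyContinuousOnInterval U (-1) 1 ∧ (∀ x ∈ uIcc (-1 : ℝ) 1, U x = u x) ∧
      ∀ᵐ x, x ∈ uIcc (-1 : ℝ) 1 → deriv U x = v x := by
    intro u v h
    have hac := h.1.absolutelyContinuousOnInterval_intervalIntegral (c := -1) left_mem_uIcc
    refine ⟨fun x => (∫ t in (-1)..x, v t) + u (-1), ?_, ?_, ?_⟩
    · have hc : AbsolutelyContinuousOnInterval (fun _ : ℝ => u (-1)) (-1) 1 :=
        ((LipschitzWith.const (u (-1))).lipschitzOnWith).absolutelyContinuousOnInterval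
      exact hac.add hc
    · intro x hx
      rw [uIcc_of_le (by norm_num)] at hx
      rw [h.2 x hx, add_comm]
    · filter_upwards [h.1.ae_hasDerivAt_integral] with x hx hxm
      exact ((hx hxm (-1) left_mem_uIcc).add_const _).deriv
  obtain ⟨U, hU, hUu, hUd⟩ := key h
  obtain ⟨V, hV, hVφ, hVd⟩ := key h'
  have hsub : ∀ x, x ∈ uIoc (-1 : ℝ) 1 → x ∈ uIcc (-1 : ℝ) 1 := fun x hx => uIoc_subset_uIcc hx
  have e := hV.integral_mul_deriv_eq_deriv_mul hU
  have e1 : ∫ x in (-1)..1, V x * deriv U x = ∫ x in (-1)..1, v x * φ x := by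
    refine intervalIntegral.integral_congr_ae ?_
    filter_upwards [hUd] with x hx hxm
    rw [hx (hsub x hxm), hVφ x (hsub x hxm), mul_comm]
  have e2 : ∫ x in (-1)..1, deriv V x * U x = ∫ x in (-1)..1, u x * ψ x := by
    refine intervalIntegral.integral_congr_ae ?_
    filter_upwards [hVd] with x hx hxm
    rw [hx (hsub x hxm), hUu x (hsub x hxm), mul_comm]
  rw [integral_muOmega, integral_muOmega, ← e1, e, e2, hUu 1 right_mem_uIcc, hUu _ left_mem_uIcc,
    hVφ 1 right_mem_uIcc, hVφ _ left_mem_uIcc]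
  ring

/-- `f 0, …, f M` are the successive derivatives of a function in `H^M(Ω)`: each is an indefinite
integral of the next, and the last one lies in `L²(Ω)`. -/
def SobolevChain (M : ℕ) (f : ℕ → ℝ → ℝ) : Prop :=
  (∀ i < M, IsPrimitive (f i) (f (i + 1))) ∧ MemLp (f M) 2 muOmega

theorem SobolevChain.memLp {M : ℕ} {f : ℕ → ℝ → ℝ} (h : SobolevChain M f) {i : ℕ} (hi : i ≤ M) :
    MemLp (f i) 2 muOmega := by
  rcases hi.eq_or_lt with rfl | hi
  · exact h.2
  · exact (h.1 i hi).memLp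

theorem SobolevChain.shift {M : ℕ} {f : ℕ → ℝ → ℝ} {a : ℕ} (h : SobolevChain (M + a) f) :
    SobolevChain M fun i => f (i + a) :=
  ⟨fun i hi => by
    have h1 := h.1 (i + a) (by omega)
    rwa [add_right_comm] at h1, h.2⟩

theorem sobolevChain_poly (M : ℕ) (q : ℝ[X]) :
    SobolevChain M fun i x => (derivative^[i] q).eval x :=
  ⟨fun i _ => by
    simp only [Function.iterate_succ_apply']
    exact isPrimitive_poly _, memLp_poly _⟩



/-! ### Orthogonality of Legendre polynomials -/

/-- `(1 - x²)^j L_m^(j)`, a multiple of an antiderivative of order `j` of `L_m`. -/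
noncomputable def weightedLegendre (m j : ℕ) : ℝ[X] :=
  (1 - X ^ 2) ^ j * derivative^[j] (legendre m)

/-- Integration by parts against the Sturm-Liouville equation; the weight removes the boundary
terms. -/
theorem IsPrimitive.integral_mul_weightedLegendre {u v : ℝ → ℝ} (h : IsPrimitive u v)
    (m j : ℕ) :
    ∫ x, v x * (weightedLegendre m (j + 1)).eval x ∂muOmega =
      (m - j) * (m + j + 1) * ∫ x, u x * (weightedLegendre m j).eval x ∂muOmega := by
  rw [h.integral_mul (isPrimitive_poly _), weightedLegendre,
    derivative_weight_mul_iterate_derivative_legendre]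
  simp only [eval_mul, eval_pow, eval_sub, eval_one, eval_X, eval_neg, eval_C]
  rw [← integral_const_mul]
  simp only [weightedLegendre, eval_mul, eval_pow, eval_sub, eval_one, eval_X]
  norm_num
  rw [← integral_neg]
  congr 1; ext x; ring

/-- The Legendre coefficients of `f 0` in terms of weighted coefficients of its derivative of
order `M`, which lies merely in `L²(Ω)`. -/
theorem SobolevChain.integral_mul_weightedLegendre {M : ℕ} {f : ℕ → ℝ → ℝ}
    (h : SobolevChain M f) {m : ℕ} (hm : M ≤ m) :
    ∫ x, f M x * (weightedLegendre m M).eval x ∂muOmega =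
      (m + M).factorial / (m - M).factorial * ∫ x, f 0 x * (legendre m).eval x ∂muOmega := by
  suffices H : ∀ j ≤ M, ∫ x, f j x * (weightedLegendre m j).eval x ∂muOmega =
      (m + j).factorial / (m - j).factorial * ∫ x, f 0 x * (legendre m).eval x ∂muOmega from
    H M le_rfl
  intro j hj
  induction j with
  | zero =>
    have : (m.factorial : ℝ) ≠ 0 := by positivity
    simp [weightedLegendre, this]
  | succ j ih =>
    rw [(h.1 j hj).integral_mul_weightedLegendre, ih (by omega)]
    obtain ⟨d, rfl⟩ : ∃ d, m = d + (j + 1) := ⟨m - (j + 1), by omega⟩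
    rw [show d + (j + 1) - j = d + 1 by omega, show d + (j + 1) - (j + 1) = d by omega,
      ← add_assoc (d + (j + 1)), Nat.factorial_succ (d + (j + 1) + j), Nat.factorial_succ d]
    have : (d.factorial : ℝ) ≠ 0 := by positivity
    push_cast
    field_simp
    ring

theorem integral_legendre_mul_legendre_of_ne {n m : ℕ} (h : n ≠ m) :
    ∫ x, (legendre n).eval x * (legendre m).eval x ∂muOmega = 0 := by
  have h1 := (isPrimitive_poly (legendre n)).integral_mul_weightedLegendre m 0
  have h2 := (isPrimitive_poly (legendre m)).integral_mul_weightedLegendre n 0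
  have e : ∫ x, (derivative (legendre n)).eval x * (weightedLegendre m (0 + 1)).eval x ∂muOmega =
      ∫ x, (derivative (legendre m)).eval x * (weightedLegendre n (0 + 1)).eval x ∂muOmega := by
    congr 1; ext x
    simp only [weightedLegendre, zero_add, Function.iterate_one, eval_mul]
    ring
  have e' : ∫ x, (legendre m).eval x * (legendre n).eval x ∂muOmega =
      ∫ x, (legendre n).eval x * (legendre m).eval x ∂muOmega := by
    congr 1; ext x; ring
  rw [h1, h2] at e
  simp only [weightedLegendre, pow_zero, one_mul, Function.iterate_zero, id] at e
  rw [e'] at e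
  have hne : ((m : ℝ) - n) * (m + n + 1) ≠ 0 :=
    mul_ne_zero (sub_ne_zero.2 (by exact_mod_cast h.symm)) (by positivity)
  apply (mul_eq_zero.1 (show ((m : ℝ) - n) * (m + n + 1) *
    ∫ x, (legendre n).eval x * (legendre m).eval x ∂muOmega = 0 from ?_)).resolve_left hne
  push_cast at e
  linear_combination e

theorem integrable_poly_mul (q r : ℝ[X]) : Integrable (fun x => q.eval x * r.eval x) muOmega :=
  integrable_mul_poly (memLp_poly q) r

theorem integral_mul_legendre_of_mem_degreeLT {m : ℕ} {q : ℝ[X]} (hq : q ∈ degreeLT ℝ m) :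
    ∫ x, q.eval x * (legendre m).eval x ∂muOmega = 0 := by
  rw [← span_legendre_degreeLT] at hq
  induction hq using Submodule.span_induction with
  | mem x hx =>
    obtain ⟨n, hn, rfl⟩ := hx
    exact integral_legendre_mul_legendre_of_ne (ne_of_lt hn)
  | zero => simp
  | add x y _ _ hx hy =>
    simp only [eval_add, add_mul]
    rw [integral_add (integrable_poly_mul _ _) (integrable_poly_mul _ _), hx, hy, add_zero]
  | smul c x _ hx =>
    simp only [eval_smul, smul_eq_mul, mul_assoc]
    rw [integral_const_mul, hx, mul_zero]

/-- Integrate `(x L_n²)' = 2 L_{n-1}' L_n + (2n + 1) L_n²`, where `L_{n-1}'` is orthogonal to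
`L_n`. -/
theorem integral_legendre_sq (n : ℕ) :
    ∫ x, (legendre n).eval x * (legendre n).eval x ∂muOmega = 2 / (2 * n + 1) := by
  cases n with
  | zero => rw [integral_muOmega]; simp [legendre_zero]; norm_num
  | succ n =>
    have hdeg : derivative (legendre n) ∈ degreeLT ℝ ((n + 1 : ℕ)) := by
      rw [mem_degreeLT]
      refine (degree_derivative_le).trans_lt ?_
      rw [degree_legendre]
      exact_mod_cast n.lt_succ_self
    have h0 := integral_mul_legendre_of_mem_degreeLT hdeg
    have hp := (isPrimitive_poly (X * legendre (n + 1) ^ 2)).integral_mul (isPrimitive_poly 1)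
    have e : derivative (X * legendre (n + 1) ^ 2) =
        2 * (derivative (legendre n) * legendre (n + 1)) +
          C (2 * n + 3 : ℝ) * (legendre (n + 1) * legendre (n + 1)) := by
      have hB := X_mul_derivative_legendre_succ n
      rw [derivative_mul, derivative_X, derivative_pow]
      simp only [map_add, map_mul, map_natCast, map_ofNat, map_one] at hB ⊢
      push_cast
      linear_combination 2 * legendre (n + 1) * hB
    rw [e] at hp
    simp only [eval_add, eval_mul, eval_C, eval_one, eval_ofNat, mul_one, derivative_one, eval_zero,
      mul_zero, eval_X, eval_pow, eval_one_legendre, eval_neg_one_legendre, integral_zero] at hp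
    rw [integral_add ((integrable_poly_mul _ _).const_mul _)
      ((integrable_poly_mul _ _).const_mul _), integral_const_mul, integral_const_mul, h0] at hp
    rw [eq_div_iff (by positivity)]
    have h1 : ((-1 : ℝ) ^ (n + 1)) ^ 2 = 1 := by rw [← pow_mul, mul_comm, pow_mul]; norm_num
    rw [h1] at hp
    push_cast
    linear_combination hp

theorem integral_mul_nonneg_of_mem_cone {q r : ℝ[X]} (hq : q ∈ legendreCone)
    (hr : r ∈ legendreCone) : 0 ≤ ∫ x, q.eval x * r.eval x ∂muOmega := by
  induction hq using Submodule.span_induction with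
  | zero => simp
  | add x y _ _ hx hy =>
    simp only [eval_add, add_mul]
    rw [integral_add (integrable_poly_mul _ _) (integrable_poly_mul _ _)]
    exact add_nonneg hx hy
  | smul c x _ hx =>
    simp only [NNReal.smul_def, eval_smul, smul_eq_mul, mul_assoc]
    rw [integral_const_mul]
    exact mul_nonneg c.2 hx
  | mem x hx =>
    obtain ⟨n, rfl⟩ := hx
    induction hr using Submodule.span_induction with
    | zero => simp
    | add x y _ _ hx hy =>
      simp only [eval_add, mul_add]
      rw [integral_add (integrable_poly_mul _ _) (integrable_poly_mul _ _)]
      exact add_nonneg hx hy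
    | smul c x _ hx =>
      simp only [NNReal.smul_def, eval_smul, smul_eq_mul, mul_left_comm _ (c : ℝ)]
      rw [integral_const_mul]
      exact mul_nonneg c.2 hx
    | mem x hx =>
      obtain ⟨m, rfl⟩ := hx
      rcases eq_or_ne n m with rfl | h
      · exact integral_nonneg fun x => mul_self_nonneg _
      · rw [integral_legendre_mul_legendre_of_ne h]

/-- Integration by parts moves a derivative from one factor to the other; the remaining integral
`∫ L_n^(j) L_n^(j+2)` is nonnegative, because derivatives of Legendre polynomials are nonnegative
combinations of Legendre polynomials. -/
theorem integral_iterate_derivative_legendre_sq_le (n j : ℕ) :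
    ∫ x, (derivative^[j + 1] (legendre n)).eval x ^ 2 ∂muOmega ≤
      2 * endVal n j * endVal n (j + 1) := by
  have h := (isPrimitive_poly (derivative^[j] (legendre n))).integral_mul
    (isPrimitive_poly (derivative^[j + 1] (legendre n)))
  have h0 := integral_mul_nonneg_of_mem_cone (iterate_derivative_legendre_mem_cone n j)
    (iterate_derivative_legendre_mem_cone n (j + 2))
  simp only [← Function.iterate_succ_apply' derivative, eval_one_iterate_derivative_legendre,
    eval_neg_one_iterate_derivative_legendre] at h
  simp only [pow_two]
  have h1 : (-1 : ℝ) ^ (n + j) * endVal n j * ((-1) ^ (n + (j + 1)) * endVal n (j + 1)) =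
      -(endVal n j * endVal n (j + 1)) := by
    have : ((-1 : ℝ) ^ (n + j)) ^ 2 = 1 := by rw [← pow_mul, mul_comm, pow_mul]; norm_num
    rw [← add_assoc, pow_succ]
    linear_combination (-endVal n j * endVal n (j + 1)) * this
  rw [h1] at h
  linarith [h, h0]

/-! ### Legendre expansions -/

/-- The unnormalized Legendre coefficient `(u, L_m)`. -/
noncomputable def legendreCoeff (u : ℝ → ℝ) (m : ℕ) : ℝ :=
  ∫ x, u x * (legendre m).eval x ∂muOmega

/-- The part of the Legendre expansion of `u` with indices in `F`. -/
noncomputable def legendreSum (F : Finset ℕ) (u : ℝ → ℝ) : ℝ[X] :=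
  ∑ m ∈ F, C ((2 * m + 1) / 2 * legendreCoeff u m : ℝ) * legendre m

theorem integral_mul_sum_C_mul {u : ℝ → ℝ} (hu : MemLp u 2 muOmega) (F : Finset ℕ) (a : ℕ → ℝ)
    (q : ℕ → ℝ[X]) :
    ∫ x, u x * (∑ m ∈ F, C (a m) * q m).eval x ∂muOmega =
      ∑ m ∈ F, a m * ∫ x, u x * (q m).eval x ∂muOmega := by
  simp only [eval_finsetSum, eval_mul, eval_C, Finset.mul_sum, mul_left_comm (u _)]
  rw [integral_finsetSum]
  · simp only [integral_const_mul]
  · intro m _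
    exact (integrable_mul_poly hu (q m)).const_mul _

theorem integral_mul_legendreSum {u v : ℝ → ℝ} (hu : MemLp u 2 muOmega) (F : Finset ℕ) :
    ∫ x, u x * (legendreSum F v).eval x ∂muOmega =
      ∑ m ∈ F, (2 * m + 1) / 2 * legendreCoeff v m * legendreCoeff u m :=
  integral_mul_sum_C_mul hu F _ _

theorem legendreCoeff_legendreSum {F : Finset ℕ} {m : ℕ} (hm : m ∈ F) (u : ℝ → ℝ) :
    legendreCoeff (fun x => (legendreSum F u).eval x) m = legendreCoeff u m := by
  have h := integral_mul_legendreSum (v := u) (memLp_poly (legendre m)) F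
  rw [legendreCoeff]
  simp only [mul_comm ((legendreSum F u).eval _)]
  rw [h, Finset.sum_eq_single m]
  · simp only [legendreCoeff, integral_legendre_sq]
    field_simp
  · intro n _ hn
    simp only [legendreCoeff, integral_legendre_mul_legendre_of_ne hn.symm, mul_zero]
  · exact fun h => absurd hm h

theorem legendreSum_mem_degreeLE (p : ℕ) (u : ℝ → ℝ) :
    legendreSum (Finset.range (p + 1)) u ∈ degreeLE ℝ p := by
  refine Submodule.sum_mem _ fun m hm => ?_
  rw [← smul_eq_C_mul]
  refine Submodule.smul_mem _ _ (mem_degreeLE.2 ?_)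
  rw [degree_legendre]
  exact_mod_cast Finset.mem_range_succ_iff.1 hm

theorem isL2Proj_legendreSum (p : ℕ) {u : ℝ → ℝ} (hu : MemLp u 2 muOmega) :
    IsL2Proj p u (legendreSum (Finset.range (p + 1)) u) := by
  refine ⟨legendreSum_mem_degreeLE p u, fun v hv => ?_⟩
  rw [← span_legendre_degreeLE] at hv
  have hS : MemLp (fun x => (legendreSum (Finset.range (p + 1)) u).eval x - u x) 2 muOmega :=
    (memLp_poly _).sub hu
  change ∫ x, _ ∂muOmega = 0
  induction hv using Submodule.span_induction with
  | mem x hx =>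
    obtain ⟨n, hn, rfl⟩ := hx
    have h := legendreCoeff_legendreSum (F := Finset.range (p + 1))
      (Finset.mem_range_succ_iff.2 hn) u
    simp only [sub_mul]
    rw [integral_sub (integrable_poly_mul _ _) (integrable_mul_poly hu _)]
    exact sub_eq_zero.2 h
  | zero => simp
  | add x y _ _ hx hy =>
    simp only [eval_add, mul_add]
    rw [integral_add (integrable_mul_poly hS _) (integrable_mul_poly hS _), hx, hy, add_zero]
  | smul c x _ hx =>
    simp only [eval_smul, smul_eq_mul, mul_left_comm _ c]
    rw [integral_const_mul, hx, mul_zero]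

theorem l2Proj_eq_legendreSum (p : ℕ) {u : ℝ → ℝ} (hu : MemLp u 2 muOmega) :
    l2Proj p u = legendreSum (Finset.range (p + 1)) u :=
  (l2Proj_spec p hu).unique hu (isL2Proj_legendreSum p hu)

theorem integral_sub_legendreSum_sq (F : Finset ℕ) {u : ℝ → ℝ} (hu : MemLp u 2 muOmega) :
    ∫ x, (u x - (legendreSum F u).eval x) ^ 2 ∂muOmega =
      ∫ x, u x ^ 2 ∂muOmega - ∑ m ∈ F, (2 * m + 1) / 2 * legendreCoeff u m ^ 2 := by
  have h1 := integral_mul_legendreSum (v := u) hu F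
  have h2 := integral_mul_legendreSum (v := u) (memLp_poly (legendreSum F u)) F
  have h3 : ∑ m ∈ F, (2 * m + 1) / 2 * legendreCoeff u m *
      legendreCoeff (fun x => (legendreSum F u).eval x) m =
      ∑ m ∈ F, (2 * m + 1) / 2 * legendreCoeff u m ^ 2 :=
    Finset.sum_congr rfl fun m hm => by rw [legendreCoeff_legendreSum hm]; ring
  have h4 : ∑ m ∈ F, (2 * m + 1) / 2 * legendreCoeff u m * legendreCoeff u m =
      ∑ m ∈ F, (2 * m + 1) / 2 * legendreCoeff u m ^ 2 :=
    Finset.sum_congr rfl fun m hm => by ring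
  rw [h3] at h2
  rw [h4] at h1
  have i1 : Integrable (fun x => u x * (legendreSum F u).eval x) muOmega :=
    integrable_mul_poly hu _
  have i2 := integrable_poly_mul (legendreSum F u) (legendreSum F u)
  have e : ∀ x, (u x - (legendreSum F u).eval x) ^ 2 =
      u x ^ 2 - 2 * (u x * (legendreSum F u).eval x) +
        (legendreSum F u).eval x * (legendreSum F u).eval x := fun x => by ring
  have i3 : Integrable (fun x => u x ^ 2 - 2 * (u x * (legendreSum F u).eval x)) muOmega :=
    hu.integrable_sq.sub (i1.const_mul 2)
  simp only [e]
  rw [integral_add i3 i2,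
    integral_sub hu.integrable_sq (i1.const_mul 2), integral_const_mul, h1, h2]
  ring

/-- Partial sums of the Legendre expansion are best approximations in `L²(Ω)`. -/
theorem integral_sub_legendreSum_sq_le (p : ℕ) {u : ℝ → ℝ} (hu : MemLp u 2 muOmega) {q : ℝ[X]}
    (hq : q ∈ degreeLE ℝ p) :
    ∫ x, (u x - (legendreSum (Finset.range (p + 1)) u).eval x) ^ 2 ∂muOmega ≤
      ∫ x, (u x - q.eval x) ^ 2 ∂muOmega := by
  set S := legendreSum (Finset.range (p + 1)) u
  have hS : IsL2Proj p u S := isL2Proj_legendreSum p hu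
  have h0 : ∫ x, (S.eval x - u x) * (S - q).eval x ∂muOmega = 0 :=
    hS.2 _ (Submodule.sub_mem _ hS.1 hq)
  have i0 : Integrable (fun x => (S.eval x - u x) * (S - q).eval x) muOmega :=
    integrable_mul_poly ((memLp_poly S).sub hu) _
  have i1 : Integrable (fun x => (u x - q.eval x) ^ 2) muOmega :=
    (hu.sub (memLp_poly q)).integrable_sq
  have i2 : Integrable (fun x => (u x - S.eval x) ^ 2) muOmega :=
    (hu.sub (memLp_poly S)).integrable_sq
  have h1 : ∫ x, ((u x - S.eval x) ^ 2 - 2 * ((S.eval x - u x) * (S - q).eval x)) ∂muOmega ≤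
      ∫ x, (u x - q.eval x) ^ 2 ∂muOmega := by
    refine integral_mono (i2.sub (i0.const_mul 2)) i1 fun x => ?_
    simp only [eval_sub]
    nlinarith [sq_nonneg (S.eval x - q.eval x)]
  rw [integral_sub i2 (i0.const_mul 2), integral_const_mul, h0] at h1
  linarith

/-- Bessel's inequality for the derivative of order `M`, in the space weighted by `(1 - x²)^M`. -/
theorem SobolevChain.bessel {M : ℕ} {f : ℕ → ℝ → ℝ} (h : SobolevChain M f) {F : Finset ℕ}
    (hF : ∀ m ∈ F, M ≤ m) :
    ∑ m ∈ F, ((m + M).factorial / (m - M).factorial : ℝ) *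
        ((2 * m + 1) / 2 * legendreCoeff (f 0) m ^ 2) ≤ ∫ x, f M x ^ 2 ∂muOmega := by
  set P := legendreSum F (f 0) with hP
  set a : ℕ → ℝ := fun m => (2 * m + 1) / 2 * legendreCoeff (f 0) m with ha
  have hW : (1 - X ^ 2) ^ M * derivative^[M] P = ∑ m ∈ F, C (a m) * weightedLegendre m M := by
    rw [hP, legendreSum, iterate_derivative_sum, Finset.mul_sum]
    refine Finset.sum_congr rfl fun m _ => ?_
    rw [iterate_derivative_C_mul, weightedLegendre, mul_left_comm]
  -- The weighted product with `P^(M)` depends only on the Legendre coefficients with index in `F`,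
  -- which `f 0` and `P` share.
  have key : ∀ g : ℕ → ℝ → ℝ, SobolevChain M g →
      (∀ m ∈ F, legendreCoeff (g 0) m = legendreCoeff (f 0) m) →
      ∫ x, g M x * ((1 - X ^ 2) ^ M * derivative^[M] P).eval x ∂muOmega =
        ∑ m ∈ F, ((m + M).factorial / (m - M).factorial : ℝ) *
          ((2 * m + 1) / 2 * legendreCoeff (f 0) m ^ 2) := by
    intro g hg hgf
    rw [hW, integral_mul_sum_C_mul hg.2]
    refine Finset.sum_congr rfl fun m hm => ?_
    rw [hg.integral_mul_weightedLegendre (hF m hm), ← legendreCoeff, hgf m hm]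
    ring
  have k1 := key f h fun m _ => rfl
  have k2 := key _ (sobolevChain_poly M P) fun m hm => legendreCoeff_legendreSum hm (f 0)
  have i1 : Integrable (fun x => f M x * ((1 - X ^ 2) ^ M * derivative^[M] P).eval x) muOmega :=
    integrable_mul_poly h.2 _
  have i2 := integrable_poly_mul (derivative^[M] P) ((1 - X ^ 2) ^ M * derivative^[M] P)
  have h1 : ∫ x, (2 * (f M x * ((1 - X ^ 2) ^ M * derivative^[M] P).eval x) -
      (derivative^[M] P).eval x * ((1 - X ^ 2) ^ M * derivative^[M] P).eval x) ∂muOmega ≤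
        ∫ x, f M x ^ 2 ∂muOmega := by
    refine integral_mono_ae ((i1.const_mul 2).sub i2) h.2.integrable_sq ?_
    rw [Filter.EventuallyLE, muOmega,
      ae_restrict_iff' (show MeasurableSet Omega from measurableSet_Ioo)]
    refine Filter.Eventually.of_forall fun x hx => ?_
    have hx2 : x ^ 2 ≤ 1 := by nlinarith [hx.1, hx.2]
    have hr0 : 0 ≤ (1 - x ^ 2) ^ M := pow_nonneg (by linarith) _
    have hr1 : (1 - x ^ 2) ^ M ≤ 1 := pow_le_one₀ (by linarith) (by nlinarith [sq_nonneg x])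
    simp only [eval_mul, eval_pow, eval_sub, eval_one, eval_X]
    nlinarith [mul_nonneg hr0 (sq_nonneg (f M x - (derivative^[M] P).eval x)),
      mul_nonneg (sub_nonneg.2 hr1) (sq_nonneg (f M x))]
  rw [integral_sub (i1.const_mul 2) i2, integral_const_mul, k1, k2] at h1
  linarith

/-- The quotient `(n - s)! / (n + s)!`. -/
noncomputable def factRatio (n s : ℕ) : ℝ := (n - s).factorial / (n + s).factorial

theorem factRatio_pos (n s : ℕ) : 0 < factRatio n s := by unfold factRatio; positivity

theorem factRatio_anti {s n m : ℕ} (hs : s ≤ n) (hnm : n ≤ m) : factRatio m s ≤ factRatio n s := by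
  induction m, hnm using Nat.le_induction with
  | base => exact le_rfl
  | succ m hnm ih =>
    refine le_trans ?_ ih
    obtain ⟨d, rfl⟩ : ∃ d, m = d + s := ⟨m - s, by omega⟩
    rw [factRatio, factRatio, show d + s + 1 - s = d + 1 by omega, show d + s - s = d by omega,
      show d + s + 1 + s = (d + s + s) + 1 by omega, Nat.factorial_succ, Nat.factorial_succ,
      div_le_div_iff₀ (by positivity) (by positivity)]
    have : (d + 1) * (d.factorial * (d + s + s).factorial) ≤
      (d + s + s + 1) * (d.factorial * (d + s + s).factorial) := by gcongr; omega
    have h2 : ((d + 1) * (d.factorial * (d + s + s).factorial) : ℝ) ≤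
      (d + s + s + 1) * (d.factorial * (d + s + s).factorial) := by exact_mod_cast this
    push_cast
    linarith

theorem SobolevChain.legendreCoeff_sq_le {M : ℕ} {f : ℕ → ℝ → ℝ} (h : SobolevChain M f) {m : ℕ}
    (hm : M ≤ m) :
    legendreCoeff (f 0) m ^ 2 ≤ 2 / (2 * m + 1) * factRatio m M * ∫ x, f M x ^ 2 ∂muOmega := by
  have hb := h.bessel (F := {m}) (by simpa using hm)
  rw [Finset.sum_singleton] at hb
  refine le_trans (le_of_eq ?_) (mul_le_mul_of_nonneg_left hb
    (mul_nonneg (by positivity) (factRatio_pos m M).le : 0 ≤ 2 / (2 * m + 1) * factRatio m M))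
  rw [factRatio]
  field_simp

/-- The truncation error in `L²(Ω)`: the error of a longer partial sum is arbitrarily small by
Weierstrass' theorem, and Bessel's inequality bounds the terms in between. -/
theorem SobolevChain.integral_sub_legendreSum_sq_le {s : ℕ} {f : ℕ → ℝ → ℝ}
    (h : SobolevChain s f) (hs : 0 < s) {n : ℕ} (hn : s ≤ n + 1) :
    ∫ x, (f 0 x - (legendreSum (Finset.range (n + 1)) (f 0)).eval x) ^ 2 ∂muOmega ≤
      factRatio (n + 1) s * ∫ x, f s x ^ 2 ∂muOmega := by
  have hf0 : MemLp (f 0) 2 muOmega := h.memLp (Nat.zero_le _)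
  refine le_of_forall_pos_le_add fun ε hε => ?_
  obtain ⟨q, hq⟩ := exists_polynomial_near_of_continuousOn (-1) 1 (f 0) (h.1 0 hs).continuousOn
    (Real.sqrt (ε / 2)) (Real.sqrt_pos.2 (by positivity))
  set N := max q.natDegree n with hN
  have hqN : q ∈ degreeLE ℝ N :=
    mem_degreeLE.2 (natDegree_le_iff_degree_le.1 (le_max_left _ _))
  have h1 : ∫ x, (f 0 x - q.eval x) ^ 2 ∂muOmega ≤ ε := by
    have hc : ∫ _, ε / 2 ∂muOmega = ε := by rw [integral_muOmega]; simp; ring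
    rw [← hc]
    refine integral_mono_ae (hf0.sub (memLp_poly q)).integrable_sq (integrable_const _) ?_
    rw [Filter.EventuallyLE, muOmega,
      ae_restrict_iff' (show MeasurableSet Omega from measurableSet_Ioo)]
    refine Filter.Eventually.of_forall fun x hx => ?_
    have := hq x (Ioo_subset_Icc_self hx)
    rw [abs_sub_comm] at this
    have h2 := pow_le_pow_left₀ (abs_nonneg _) this.le 2
    rwa [sq_abs, Real.sq_sqrt (by positivity)] at h2
  have h2 := (L2Projection.integral_sub_legendreSum_sq_le N hf0 hqN).trans h1
  rw [integral_sub_legendreSum_sq _ hf0] at h2 ⊢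
  have hsplit : ∑ m ∈ Finset.range (N + 1), (2 * m + 1) / 2 * legendreCoeff (f 0) m ^ 2 =
      ∑ m ∈ Finset.range (n + 1), (2 * m + 1) / 2 * legendreCoeff (f 0) m ^ 2 +
        ∑ m ∈ Finset.Ico (n + 1) (N + 1), (2 * m + 1) / 2 * legendreCoeff (f 0) m ^ 2 :=
    (Finset.sum_range_add_sum_Ico _ (by omega)).symm
  have htail : ∑ m ∈ Finset.Ico (n + 1) (N + 1), (2 * m + 1) / 2 * legendreCoeff (f 0) m ^ 2 ≤
      factRatio (n + 1) s * ∫ x, f s x ^ 2 ∂muOmega := by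
    refine le_trans ?_ (mul_le_mul_of_nonneg_left (h.bessel (F := Finset.Ico (n + 1) (N + 1))
      fun m hm => hn.trans (Finset.mem_Ico.1 hm).1) (factRatio_pos _ _).le)
    rw [Finset.mul_sum]
    refine Finset.sum_le_sum fun m hm => ?_
    have hm' := (Finset.mem_Ico.1 hm).1
    have ha := factRatio_anti hn hm'
    have e : factRatio m s * ((m + s).factorial / (m - s).factorial : ℝ) = 1 := by
      rw [factRatio]; field_simp
    have hpos : 0 ≤ ((m + s).factorial / (m - s).factorial : ℝ) *
        ((2 * m + 1) / 2 * legendreCoeff (f 0) m ^ 2) := by positivity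
    calc (2 * m + 1) / 2 * legendreCoeff (f 0) m ^ 2
        = factRatio m s * (((m + s).factorial / (m - s).factorial : ℝ) *
          ((2 * m + 1) / 2 * legendreCoeff (f 0) m ^ 2)) := by rw [← mul_assoc, e, one_mul]
      _ ≤ _ := mul_le_mul_of_nonneg_right ha hpos
  linarith

theorem IsPrimitive.legendreCoeff_succ {u v : ℝ → ℝ} (h : IsPrimitive u v) (n : ℕ) :
    (2 * n + 3) * legendreCoeff u (n + 1) = legendreCoeff v n - legendreCoeff v (n + 2) := by
  have h1 := h.integral_mul (isPrimitive_poly (legendre (n + 2)))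
  have h2 := h.integral_mul (isPrimitive_poly (legendre n))
  rw [derivative_legendre_add_two] at h1
  simp only [eval_add, eval_mul, eval_C, mul_add, mul_left_comm (u _), eval_one_legendre,
    eval_neg_one_legendre] at h1 h2
  rw [integral_add (integrable_mul_poly h.memLp _) ((integrable_mul_poly h.memLp _).const_mul _),
    integral_const_mul] at h1
  simp only [legendreCoeff]
  rw [pow_add] at h1
  linear_combination h1 - h2

/-- Differentiation and truncation of the Legendre expansion commute up to two terms. -/
theorem IsPrimitive.derivative_legendreSum {u v : ℝ → ℝ} (h : IsPrimitive u v) (p : ℕ) :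
    derivative (legendreSum (Finset.range (p + 2)) u) =
      legendreSum (Finset.range (p + 1)) v -
        (C (legendreCoeff v (p + 1) / 2) * derivative (legendre p) +
          C (legendreCoeff v (p + 2) / 2) * derivative (legendre (p + 1))) := by
  induction p with
  | zero =>
    have h1 := h.legendreCoeff_succ 0
    simp only [legendreSum, Finset.sum_range_succ, Finset.range_zero, Finset.sum_empty,
      legendre_zero, zero_add, legendre_one, derivative_add, derivative_C, derivative_one,
      derivative_C_mul, derivative_X, mul_zero, mul_one, zero_add, ← C_sub]
    push_cast at h1 ⊢
    refine congrArg C ?_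
    linear_combination h1 / 2
  | succ p ih =>
    have h1 := h.legendreCoeff_succ (p + 1)
    have h2 := derivative_legendre_add_two p
    rw [legendreSum, Finset.sum_range_succ, ← legendreSum, derivative_add, ih,
      legendreSum, legendreSum, Finset.sum_range_succ _ (p + 1), derivative_C_mul]
    have h3 : (2 * ((p + 2 : ℕ) : ℝ) + 1) / 2 * legendreCoeff u (p + 2) =
        legendreCoeff v (p + 1) / 2 - legendreCoeff v (p + 3) / 2 := by
      push_cast at h1 ⊢
      linear_combination h1 / 2
    have h4 : (2 * ((p + 1 : ℕ) : ℝ) + 1) / 2 * legendreCoeff v (p + 1) =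
        legendreCoeff v (p + 1) / 2 * (2 * p + 3) := by
      push_cast; ring
    rw [show p + 1 + 1 = p + 2 from rfl, h3, h4, C_sub, C_mul]
    linear_combination C (legendreCoeff v (p + 1) / 2) * h2

/-! ### Weak derivatives -/

/-- The test functions on `Ω`: smooth functions with compact support in `Ω`. -/
def IsTest (φ : ℝ → ℝ) : Prop :=
  ContDiff ℝ ∞ φ ∧ HasCompactSupport φ ∧ tsupport φ ⊆ Omega

theorem IsTest.deriv {φ : ℝ → ℝ} (h : IsTest φ) : IsTest (deriv φ) :=
  ⟨(contDiff_infty_iff_deriv.1 h.1).2, h.2.1.deriv, tsupport_deriv_subset.trans h.2.2⟩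

theorem IsTest.iteratedDeriv {φ : ℝ → ℝ} (h : IsTest φ) (m : ℕ) : IsTest (iteratedDeriv m φ) := by
  induction m with
  | zero => rwa [iteratedDeriv_zero]
  | succ m ih => rw [iteratedDeriv_succ]; exact ih.deriv

theorem IsTest.eq_zero {φ : ℝ → ℝ} (h : IsTest φ) {x : ℝ} (hx : x ∉ Omega) : φ x = 0 :=
  image_eq_zero_of_notMem_tsupport fun h' => hx (h.2.2 h')

theorem IsTest.hasDerivAt {φ : ℝ → ℝ} (h : IsTest φ) (x : ℝ) :
    HasDerivAt φ (_root_.deriv φ x) x :=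
  (h.1.differentiable (by simp) x).hasDerivAt

theorem IsTest.isPrimitive {φ : ℝ → ℝ} (h : IsTest φ) : IsPrimitive φ (_root_.deriv φ) :=
  isPrimitive_of_hasDerivAt h.hasDerivAt h.deriv.1.continuous

theorem IsTest.integrable_mul {φ u : ℝ → ℝ} (h : IsTest φ) (hu : MemLp u 2 muOmega) :
    Integrable (fun x => u x * φ x) muOmega :=
  hu.integrable_mul (memLp_of_continuousOn h.1.continuous.continuousOn)

theorem IsPrimitive.integral_mul_test {u v φ : ℝ → ℝ} (h : IsPrimitive u v) (hφ : IsTest φ) :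
    ∫ x, u x * deriv φ x ∂muOmega = -∫ x, v x * φ x ∂muOmega := by
  rw [h.integral_mul hφ.isPrimitive, hφ.eq_zero (x := 1) (by simp [Omega]),
    hφ.eq_zero (x := -1) (by simp [Omega])]
  ring

theorem locallyIntegrableOn_of_memLp {u : ℝ → ℝ} (h : MemLp u 2 muOmega) :
    LocallyIntegrableOn u Omega volume :=
  IntegrableOn.locallyIntegrableOn (h.integrable (by norm_num))

/-- The members of a chain are generalized derivatives of the first one. -/
theorem SobolevChain.isWeakDeriv {M : ℕ} {f : ℕ → ℝ → ℝ} (h : SobolevChain M f) {u : ℝ → ℝ}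
    (hu : u =ᵐ[muOmega] f 0) {m : ℕ} (hm : m ≤ M) : IsWeakDeriv m u (f m) := by
  refine ⟨locallyIntegrableOn_of_memLp ((memLp_congr_ae hu).2 (h.memLp (Nat.zero_le _))),
    locallyIntegrableOn_of_memLp (h.memLp hm), fun φ h1 h2 h3 => ?_⟩
  have e : ∫ x in Omega, u x * iteratedDeriv m φ x =
      ∫ x, f 0 x * iteratedDeriv m φ x ∂muOmega := by
    refine integral_congr_ae ?_
    filter_upwards [hu] with x hx
    rw [hx]
  rw [e]
  have hφ : IsTest φ := ⟨h1, h2, h3⟩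
  clear h1 h2 h3 e
  induction m generalizing φ with
  | zero => simp [muOmega]
  | succ m ih =>
    rw [iteratedDeriv_succ', ih (by omega) _ hφ.deriv, pow_succ]
    have := (h.1 m hm).integral_mul_test hφ
    rw [muOmega] at this
    rw [this]
    ring

theorem exists_derivative_eq (P : ℝ[X]) : ∃ Q : ℝ[X], derivative Q = P := by
  induction P using Polynomial.induction_on' with
  | add p q hp hq =>
    obtain ⟨a, rfl⟩ := hp
    obtain ⟨b, rfl⟩ := hq
    exact ⟨a + b, derivative_add⟩
  | monomial n a =>
    refine ⟨monomial (n + 1) (a / (n + 1)), ?_⟩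
    have : (n + 1 : ℝ) ≠ 0 := by positivity
    rw [derivative_monomial, Nat.add_sub_cancel]
    push_cast
    rw [div_mul_cancel₀ _ this]

theorem exists_isTest_integral_eq_one : ∃ θ : ℝ → ℝ, IsTest θ ∧ ∫ x, θ x ∂muOmega = 1 := by
  let b : ContDiffBump (0 : ℝ) := ⟨1 / 4, 1 / 2, by norm_num, by norm_num⟩
  have hs : tsupport (b.normed volume) ⊆ Omega := by
    rw [b.tsupport_normed_eq]
    intro x hx
    rw [Metric.mem_closedBall, Real.dist_eq, sub_zero] at hx
    have hx' : |x| ≤ 1 / 2 := hx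
    rw [abs_le] at hx'
    exact ⟨by linarith [hx'.1], by linarith [hx'.2]⟩
  refine ⟨b.normed volume, ⟨b.contDiff_normed, b.hasCompactSupport_normed, hs⟩, ?_⟩
  rw [← b.integral_normed (μ := volume), muOmega]
  exact setIntegral_eq_integral_of_forall_compl_eq_zero fun x hx =>
    image_eq_zero_of_notMem_tsupport fun h' => hx (hs h')

theorem exists_lt_one_forall_eq_zero_of_isTest {φ : ℝ → ℝ} (h : IsTest φ) :
    ∃ r < 1, ∀ x, r < |x| → φ x = 0 := by
  rcases (tsupport φ).eq_empty_or_nonempty with he | hne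
  · exact ⟨0, by norm_num, fun x _ => image_eq_zero_of_notMem_tsupport (by simp [he])⟩
  · have hK : IsCompact (tsupport φ) := h.2.1
    obtain ⟨y, hy, hmax⟩ := hK.exists_isMaxOn hne continuous_abs.continuousOn
    refine ⟨|y|, abs_lt.2 (h.2.2 hy), fun x hx => image_eq_zero_of_notMem_tsupport fun hm => ?_⟩
    exact absurd (hmax hm) (not_le.2 hx)

/-- A test function with vanishing integral is the derivative of a test function. -/
theorem IsTest.exists_deriv_eq {φ : ℝ → ℝ} (h : IsTest φ) (h0 : ∫ x, φ x ∂muOmega = 0) :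
    ∃ χ, IsTest χ ∧ _root_.deriv χ = φ := by
  have hd : ∀ x, HasDerivAt (fun x => ∫ t in (-1)..x, φ t) (φ x) x := fun x =>
    (h.1.continuous.integral_hasStrictDerivAt (-1) x).hasDerivAt
  have hde : _root_.deriv (fun x => ∫ t in (-1)..x, φ t) = φ := funext fun x => (hd x).deriv
  obtain ⟨r, hr1, hr⟩ := exists_lt_one_forall_eq_zero_of_isTest h
  have hz : ∀ x, max r 0 < |x| → ∫ t in (-1)..x, φ t = 0 := by
    intro x hx
    have hrx := (le_max_left _ _).trans_lt hx
    have hx0 := (le_max_right _ _).trans_lt hx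
    rcases le_total 0 x with hxp | hxn
    · rw [abs_of_nonneg hxp] at hrx
      rw [integral_muOmega] at h0
      rw [← intervalIntegral.integral_add_adjacent_intervals (b := 1)
        (h.1.continuous.intervalIntegrable _ _) (h.1.continuous.intervalIntegrable _ _), h0,
        zero_add]
      refine intervalIntegral.integral_zero_ae (Filter.Eventually.of_forall fun t ht => hr t ?_)
      have ht' : min 1 x < t := ht.1
      exact (lt_min hr1 hrx).trans (ht'.trans_le (le_abs_self t))
    · rw [abs_of_nonpos hxn] at hrx
      refine intervalIntegral.integral_zero_ae (Filter.Eventually.of_forall fun t ht => hr t ?_)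
      have ht' : t ≤ max (-1) x := ht.2
      have : max (-1) x < -r := max_lt (by linarith) (by linarith)
      exact lt_of_lt_of_le (by linarith) (neg_le_abs t)
  have hts : tsupport (fun x => ∫ t in (-1)..x, φ t) ⊆ Icc (-(max r 0)) (max r 0) := by
    refine closure_minimal (fun x hx => ?_) isClosed_Icc
    rw [mem_Icc, ← abs_le]
    by_contra hc
    exact hx (hz x (not_le.1 hc))
  have hr0 : max r 0 < 1 := max_lt hr1 one_pos
  refine ⟨_, ⟨?_, ?_, ?_⟩, hde⟩
  · rw [contDiff_infty_iff_deriv, hde]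
    exact ⟨fun x => (hd x).differentiableAt, h.1⟩
  · exact isCompact_Icc.of_isClosed_subset (isClosed_tsupport _) hts
  · exact hts.trans fun x hx => ⟨by linarith [hx.1], by linarith [hx.2]⟩

theorem IsTest.add_const_mul {φ ψ : ℝ → ℝ} (hφ : IsTest φ) (hψ : IsTest ψ) (c : ℝ) :
    IsTest fun x => φ x + c * ψ x := by
  have hs : tsupport (fun x => φ x + c * ψ x) ⊆ tsupport φ ∪ tsupport ψ := by
    refine closure_minimal (fun x hx => ?_) ((isClosed_tsupport _).union (isClosed_tsupport _))
    by_contra hc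
    rw [mem_union, not_or] at hc
    exact hx (by simp [image_eq_zero_of_notMem_tsupport hc.1,
      image_eq_zero_of_notMem_tsupport hc.2])
  exact ⟨hφ.1.add (contDiff_const.mul hψ.1),
    (IsCompact.union hφ.2.1 hψ.2.1).of_isClosed_subset (isClosed_tsupport _) hs,
    hs.trans (union_subset hφ.2.2 hψ.2.2)⟩

/-- The lemma of du Bois-Reymond of order `M`: a linear functional on test functions that vanishes
on derivatives of order `M` is integration against a polynomial. -/
theorem exists_polynomial_of_vanish_iteratedDeriv (M : ℕ) (Λ : (ℝ → ℝ) → ℝ)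
    (hlin : ∀ φ ψ, IsTest φ → IsTest ψ → ∀ c : ℝ, Λ (fun x => φ x + c * ψ x) = Λ φ + c * Λ ψ)
    (hvan : ∀ φ, IsTest φ → Λ (iteratedDeriv M φ) = 0) :
    ∃ P : ℝ[X], ∀ φ, IsTest φ → Λ φ = ∫ x, P.eval x * φ x ∂muOmega := by
  induction M generalizing Λ with
  | zero => exact ⟨0, fun φ hφ => by simpa using hvan φ hφ⟩
  | succ M ih =>
    obtain ⟨P, hP⟩ := ih (fun φ => Λ (deriv φ)) (by
        intro φ ψ hφ hψ c
        rw [← hlin _ _ hφ.deriv hψ.deriv]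
        congr 1
        ext x
        exact ((hφ.hasDerivAt x).add ((hψ.hasDerivAt x).const_mul c)).deriv) (by
        intro φ hφ
        rw [← iteratedDeriv_succ]
        exact hvan φ hφ)
    -- With `Q' = P` and `∫ θ = 1`, every test function is `φ = χ' + (∫ φ) θ`, so that
    -- `Λ φ = -∫ Q χ' + (∫ φ) Λ θ`.
    obtain ⟨Q, rfl⟩ := exists_derivative_eq P
    obtain ⟨θ, hθ, hθ1⟩ := exists_isTest_integral_eq_one
    refine ⟨C (∫ x, Q.eval x * θ x ∂muOmega + Λ θ) - Q, fun φ hφ => ?_⟩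
    set c := ∫ x, φ x ∂muOmega with hc
    have hiφ : Integrable φ muOmega :=
      (memLp_of_continuousOn hφ.1.continuous.continuousOn).integrable (by norm_num)
    have hiθ : Integrable θ muOmega :=
      (memLp_of_continuousOn hθ.1.continuous.continuousOn).integrable (by norm_num)
    have hψ := hφ.add_const_mul hθ (-c)
    have h0 : ∫ x, φ x + -c * θ x ∂muOmega = 0 := by
      rw [integral_add hiφ (hiθ.const_mul _), integral_const_mul, hθ1, ← hc]
      ring
    obtain ⟨χ, hχ, hχd⟩ := hψ.exists_deriv_eq h0
    have h1 := hP χ hχ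
    have h2 := (isPrimitive_poly Q).integral_mul_test hχ
    rw [hχd] at h2
    simp only [hχd] at h1
    rw [hlin _ _ hφ hθ] at h1
    have iQφ := hφ.integrable_mul (memLp_poly Q)
    have iQθ := hθ.integrable_mul (memLp_poly Q)
    have e1 : ∫ x, Q.eval x * (φ x + -c * θ x) ∂muOmega =
        ∫ x, Q.eval x * φ x ∂muOmega - c * ∫ x, Q.eval x * θ x ∂muOmega := by
      rw [← integral_const_mul, ← integral_sub iQφ (iQθ.const_mul c)]
      congr 1; ext x; ring
    simp only [eval_sub, eval_C, sub_mul]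
    rw [integral_sub (hiφ.const_mul _) iQφ, integral_const_mul, ← hc]
    linarith

theorem exists_sobolevChain_eq (M : ℕ) {g : ℝ → ℝ} (hg : MemLp g 2 muOmega) :
    ∃ f, SobolevChain M f ∧ f M = g := by
  induction M with
  | zero => exact ⟨fun _ => g, ⟨fun i hi => absurd hi (Nat.not_lt_zero i), hg⟩, rfl⟩
  | succ M ih =>
    obtain ⟨f, hf, rfl⟩ := ih
    refine ⟨fun i => Nat.casesOn i (fun x => ∫ t in (-1)..x, f 0 t) f, ⟨fun i hi => ?_, hg⟩, rfl⟩
    cases i with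
    | zero =>
      refine ⟨integrable_muOmega_iff.1 ((hf.memLp (Nat.zero_le _)).integrable (by norm_num)), ?_⟩
      intro x _
      simp
    | succ i => exact hf.1 i (by omega)

theorem SobolevChain.add {M : ℕ} {f g : ℕ → ℝ → ℝ} (hf : SobolevChain M f)
    (hg : SobolevChain M g) : SobolevChain M fun i x => f i x + g i x :=
  ⟨fun i hi => (hf.1 i hi).add (hg.1 i hi), hf.2.add hg.2⟩

/-- A function with a weak derivative of order `M` in `L²(Ω)` agrees almost everywhere with an
iterated indefinite integral; in particular the intermediate derivatives exist. -/
theorem IsWeakDeriv.exists_sobolevChain {M : ℕ} {w g : ℝ → ℝ} (hw : MemLp w 2 muOmega)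
    (h : IsWeakDeriv M w g) (hg : MemLp g 2 muOmega) :
    ∃ f, SobolevChain M f ∧ w =ᵐ[muOmega] f 0 := by
  -- `w` minus an `M`-fold indefinite integral of `g` has vanishing weak derivative of order `M`,
  -- hence is a polynomial.
  obtain ⟨f, hf, rfl⟩ := exists_sobolevChain_eq M hg
  have hf0 : MemLp (f 0) 2 muOmega := hf.memLp (Nat.zero_le _)
  have hu : MemLp (fun x => w x - f 0 x) 2 muOmega := hw.sub hf0
  obtain ⟨P, hP⟩ := exists_polynomial_of_vanish_iteratedDeriv M
    (fun φ => ∫ x, (w x - f 0 x) * φ x ∂muOmega)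
    (by
      intro φ ψ hφ hψ c
      rw [← integral_const_mul, ← integral_add (hφ.integrable_mul hu)
        ((hψ.integrable_mul hu).const_mul c)]
      congr 1; ext x; ring)
    (by
      intro φ hφ
      have h1 := h.2.2 φ hφ.1 hφ.2.1 hφ.2.2
      have h2 := (hf.isWeakDeriv (Filter.EventuallyEq.refl _ _) le_rfl).2.2 φ hφ.1 hφ.2.1 hφ.2.2
      have hφM := hφ.iteratedDeriv M
      simp only [sub_mul]
      rw [integral_sub (hφM.integrable_mul hw) (hφM.integrable_mul hf0)]
      exact sub_eq_zero.2 (h1.trans h2.symm))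
  refine ⟨_, hf.add (sobolevChain_poly M P), ?_⟩
  have hl := locallyIntegrableOn_of_memLp hu
  have w1 : IsWeakDeriv 0 (fun x => w x - f 0 x) (fun x => w x - f 0 x) :=
    ⟨hl, hl, fun φ _ _ _ => by simp⟩
  have w2 : IsWeakDeriv 0 (fun x => w x - f 0 x) (fun x => P.eval x) :=
    ⟨hl, locallyIntegrableOn_of_memLp (memLp_poly P), fun φ h1 h2 h3 => by
      simpa [muOmega] using hP φ ⟨h1, h2, h3⟩⟩
  filter_upwards [w1.ae_unique w2] with x hx
  simp only [Function.iterate_zero, id]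
  linarith

/-! ### The norm of the space of square integrable functions -/

/-- The norm of `L²(Ω)` as a real number (`0` if the norm is infinite). -/
noncomputable def l2norm (u : ℝ → ℝ) : ℝ := (eLpNorm u 2 muOmega).toReal

theorem l2norm_nonneg (u : ℝ → ℝ) : 0 ≤ l2norm u := ENNReal.toReal_nonneg

theorem ofReal_l2norm {u : ℝ → ℝ} (hu : MemLp u 2 muOmega) :
    ENNReal.ofReal (l2norm u) = eLpNorm u 2 muOmega :=
  ENNReal.ofReal_toReal hu.eLpNorm_ne_top

theorem l2norm_sq {u : ℝ → ℝ} (hu : MemLp u 2 muOmega) :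
    l2norm u ^ 2 = ∫ x, u x ^ 2 ∂muOmega := by
  have h0 : 0 ≤ ∫ x, u x ^ 2 ∂muOmega := integral_nonneg fun x => sq_nonneg _
  rw [l2norm, hu.eLpNorm_eq_integral_rpow_norm (by norm_num) (by norm_num)]
  simp only [ENNReal.toReal_ofNat, Real.rpow_ofNat, Real.norm_eq_abs, sq_abs]
  rw [ENNReal.toReal_ofReal (by positivity), ← Real.rpow_natCast, ← Real.rpow_mul h0]
  norm_num

theorem l2norm_add_le {u v : ℝ → ℝ} (hu : MemLp u 2 muOmega) (hv : MemLp v 2 muOmega) :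
    l2norm (fun x => u x + v x) ≤ l2norm u + l2norm v := by
  rw [l2norm, l2norm, l2norm, ← ENNReal.toReal_add hu.eLpNorm_ne_top hv.eLpNorm_ne_top]
  exact ENNReal.toReal_mono (ENNReal.add_ne_top.2 ⟨hu.eLpNorm_ne_top, hv.eLpNorm_ne_top⟩)
    (eLpNorm_add_le hu.1 hv.1 (by norm_num))

theorem l2norm_le_of_sq_le {u : ℝ → ℝ} (hu : MemLp u 2 muOmega) {a b : ℝ} (hb : 0 ≤ b)
    (ha : 0 ≤ a) (h : ∫ x, u x ^ 2 ∂muOmega ≤ a * b ^ 2) : l2norm u ≤ √a * b := by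
  rw [← l2norm_sq hu] at h
  refine le_of_sq_le_sq ?_ (by positivity)
  rwa [mul_pow, Real.sq_sqrt ha]

/-! ### Numerical bounds for the commutators -/

/-- The square of the bound for the two terms by which differentiation and truncation fail to
commute, after `j` further derivatives. For `ν = j + 1` it is
`(2 / p) (p - σ)! / (p + σ)! L_p^(ν-1)(1) L_p^(ν)(1)` with `σ = s + ν - 1`. -/
noncomputable def commutatorBound (p s j : ℕ) : ℝ :=
  2 / p * factRatio p (s + j) * endVal p j * endVal p (j + 1)

theorem commutatorBound_nonneg {p s j : ℕ} (h : j < p) : 0 ≤ commutatorBound p s j := by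
  have h1 := (endVal_pos h.le).le
  have h2 := (endVal_pos (show j + 1 ≤ p from h)).le
  have h3 := (factRatio_pos p (s + j)).le
  unfold commutatorBound
  positivity

/-- In the recursion over the order of differentiation all commutators are bounded by the last
one. -/
theorem commutatorBound_le_succ {p s j : ℕ} (hs : 0 < s) (h : s + j + 1 < p) :
    commutatorBound p s j ≤ commutatorBound (p + 1) s (j + 1) := by
  have hf : factRatio (p + 1) (s + (j + 1)) =
      factRatio p (s + j) / ((p + s + j + 1) * (p + s + j + 2)) := by
    rw [factRatio, factRatio, show p + 1 - (s + (j + 1)) = p - (s + j) by omega,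
      show p + 1 + (s + (j + 1)) = p + (s + j) + 1 + 1 by omega, Nat.factorial_succ,
      Nat.factorial_succ]
    push_cast
    field_simp
    ring
  have h0 := commutatorBound_nonneg (s := s) (show j < p by omega)
  have hs' : (1 : ℝ) ≤ s := by exact_mod_cast hs
  have h' : (s + j + 2 : ℝ) ≤ p := by exact_mod_cast h
  have hj : (0 : ℝ) ≤ j := Nat.cast_nonneg j
  have hp : (0 : ℝ) < p := by linarith
  have e : commutatorBound (p + 1) s (j + 1) = commutatorBound p s j *
      ((p * (p + j + 2) ^ 2 * (p + j + 1) * (p + j + 3)) /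
        ((p + 1) * (p + s + j + 1) * (p + s + j + 2) * (2 * (j + 1)) * (2 * (j + 2)))) := by
    rw [commutatorBound, commutatorBound, hf, endVal_succ_succ, endVal_succ_succ]
    push_cast
    field_simp
    ring
  rw [e]
  refine le_mul_of_one_le_right h0 ((one_le_div (by positivity)).2 ?_)
  -- As `2 (j + 1) ≤ p + j - s`, the left-hand side is at most
  -- `(p + j + 1 + (s + 1)) (p + j + 1 - (s + 1))`, and similarly below.
  have a1 : (p + s + j + 2) * (2 * (j + 1)) ≤ (p + j + 1 : ℝ) ^ 2 := by nlinarith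
  have a2 : (p + s + j + 1) * (2 * (j + 2)) ≤ (p + j + 2) * (p + j + 1 : ℝ) := by nlinarith
  have a3 : (p + 1) * (p + j + 1) ≤ p * (p + j + 3 : ℝ) := by nlinarith
  calc ((p + 1) * (p + s + j + 1) * (p + s + j + 2) * (2 * (j + 1)) * (2 * (j + 2)) : ℝ)
      = (p + 1) * (((p + s + j + 2) * (2 * (j + 1))) * ((p + s + j + 1) * (2 * (j + 2)))) := by
        ring
    _ ≤ (p + 1) * ((p + j + 1) ^ 2 * ((p + j + 2) * (p + j + 1))) := by gcongr
    _ = ((p + 1) * (p + j + 1)) * ((p + j + 2) * ((p + j + 1) * (p + j + 1))) := by ring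
    _ ≤ (p * (p + j + 3)) * ((p + j + 2) * ((p + j + 2) * (p + j + 1))) := by gcongr; norm_num
    _ = _ := by ring

/-- The hypothesis `2 s + 1 ≤ p` keeps the factor `(p - j) / (p - s - j)` gained with each derivative
smaller than the square growth of the denominators of `L_p^(j)(1)`; the spare factor `4 ^ j` later
absorbs the number of commutators. -/
theorem four_pow_mul_commutatorBound_le {p s j : ℕ} (hs : 0 < s) (hsp : 2 * s + 1 ≤ p)
    (h : s + j + 1 < p) :
    4 ^ j * commutatorBound p s j ≤ (2 * p) ^ (2 * j + 1) * factRatio p s := by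
  have hR := factRatio_pos p s
  have hsp' : (2 * s + 1 : ℝ) ≤ p := by exact_mod_cast hsp
  have hs' : (1 : ℝ) ≤ s := by exact_mod_cast hs
  have hp : (0 : ℝ) < p := by linarith
  induction j with
  | zero =>
    have e : commutatorBound p s 0 = (p + 1) * factRatio p s := by
      simp [commutatorBound, endVal]
      field_simp
    rw [e]
    simp only [pow_zero, one_mul, mul_zero, zero_add, pow_one]
    gcongr
    linarith
  | succ j ih =>
    have ih := ih (by omega)
    have h' : (s + j + 3 : ℝ) ≤ p := by exact_mod_cast h
    have hj : (0 : ℝ) ≤ j := Nat.cast_nonneg j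
    have hD : (0 : ℝ) < p - s - j := by linarith
    have hf : factRatio p (s + (j + 1)) =
        factRatio p (s + j) / ((p - s - j) * (p + s + j + 1)) := by
      obtain ⟨d, rfl⟩ : ∃ d, p = d + (s + j + 1) := ⟨p - (s + j + 1), by omega⟩
      rw [factRatio, factRatio, show d + (s + j + 1) - (s + (j + 1)) = d by omega,
        show d + (s + j + 1) - (s + j) = d + 1 by omega,
        show d + (s + j + 1) + (s + (j + 1)) = d + (s + j + 1) + (s + j) + 1 by omega,
        Nat.factorial_succ, Nat.factorial_succ]
      push_cast at hD ⊢
      rw [show (d + (s + j + 1) - s - j : ℝ) = d + 1 by ring]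
      field_simp
      ring
    have e : commutatorBound p s (j + 1) = commutatorBound p s j *
        (((p - j) * (p + j + 1) * (p - j - 1) * (p + j + 2)) /
          ((p - s - j) * (p + s + j + 1) * (2 * (j + 1)) * (2 * (j + 2)))) := by
      rw [commutatorBound, commutatorBound, hf, endVal_succ p (j + 1), endVal_succ p j]
      push_cast
      field_simp
      ring
    have h0 := commutatorBound_nonneg (s := s) (show j < p by omega)
    have hq : ((p - j) * (p + j + 1) * (p - j - 1) * (p + j + 2)) /
        ((p - s - j) * (p + s + j + 1) * (2 * (j + 1)) * (2 * (j + 2))) ≤ (p : ℝ) ^ 2 := by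
      rw [div_le_iff₀ (by positivity)]
      -- `s ≤ p - s - 1` gives `p - j ≤ 2 (p - s - j) + j - 1`.
      have b1 : (p - j : ℝ) ≤ (p - s - j) * (2 * (j + 1)) * (2 * (j + 2)) := by
        nlinarith [mul_nonneg hj hD.le, mul_nonneg (mul_nonneg hj hj) hD.le]
      have b2 : (p + j + 1) * (p - j - 1) ≤ (p : ℝ) ^ 2 := by nlinarith
      have b3 : (p + j + 2 : ℝ) ≤ p + s + j + 1 := by linarith
      have c1 : (0 : ℝ) ≤ p - j := by linarith
      have c2 : (0 : ℝ) ≤ p - j - 1 := by linarith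
      calc ((p - j) * (p + j + 1) * (p - j - 1) * (p + j + 2) : ℝ)
          = ((p + j + 1) * (p - j - 1)) * ((p - j) * (p + j + 2)) := by ring
        _ ≤ p ^ 2 * (((p - s - j) * (2 * (j + 1)) * (2 * (j + 2))) * (p + s + j + 1)) := by
          gcongr
        _ = _ := by ring
    calc 4 ^ (j + 1) * commutatorBound p s (j + 1)
        = 4 * (4 ^ j * commutatorBound p s j) *
          (((p - j) * (p + j + 1) * (p - j - 1) * (p + j + 2)) /
          ((p - s - j) * (p + s + j + 1) * (2 * (j + 1)) * (2 * (j + 2)))) := by rw [e]; ring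
      _ ≤ 4 * (4 ^ j * commutatorBound p s j) * (p : ℝ) ^ 2 := by gcongr
      _ ≤ 4 * ((2 * p) ^ (2 * j + 1) * factRatio p s) * (p : ℝ) ^ 2 := by gcongr
      _ = _ := by rw [show 2 * (j + 1) + 1 = (2 * j + 1) + 2 by ring, pow_add]; ring

/-! ### The truncation error in seminorms of higher order -/

/-- The bound for one commutator term; it is used with `(m, n) = (p, p - 1)` and
`(m, n) = (p + 1, p)`. -/
theorem SobolevChain.l2norm_commutator_le {p s j m n : ℕ} {g : ℕ → ℝ → ℝ}
    (h : SobolevChain (s + j) g) (hp : s + j ≤ p) (hj : j < n) (hpm : p ≤ m) (hnp : n ≤ p)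
    (hpn : p ≤ n + 1) :
    l2norm (fun x => (C (legendreCoeff (g 0) m / 2) * derivative^[j + 1] (legendre n)).eval x) ≤
      √(commutatorBound p s j) * l2norm (g (s + j)) / 2 := by
  have hpos : (0 : ℝ) < p := by exact_mod_cast (show 0 < p by omega)
  have hend : ∀ i ≤ n, endVal n i ≤ endVal p i := by
    intro i hi
    rcases (show p = n ∨ p = n + 1 by omega) with rfl | rfl
    · exact le_rfl
    · exact endVal_le_succ (by omega)
  have e0 := (endVal_pos (show j ≤ n by omega)).le
  have e1 := (endVal_pos (show j + 1 ≤ n by omega)).le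
  have f0 := e0.trans (hend j (by omega))
  have f1 := e1.trans (hend (j + 1) (by omega))
  have hR := (factRatio_pos p (s + j)).le
  have hb := h.legendreCoeff_sq_le (hp.trans hpm)
  have hK := l2norm_nonneg (g (s + j))
  rw [← l2norm_sq h.2] at hb
  have hb' : legendreCoeff (g 0) m ^ 2 ≤ 1 / p * factRatio p (s + j) * l2norm (g (s + j)) ^ 2 := by
    refine hb.trans ?_
    have hm1 : 2 / (2 * (m : ℝ) + 1) ≤ 1 / p := by
      have : (p : ℝ) ≤ m := by exact_mod_cast hpm
      rw [div_le_div_iff₀ (by positivity) hpos]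
      linarith
    have hm2 := factRatio_anti hp hpm
    have := factRatio_pos m (s + j)
    gcongr
  have hL := integral_iterate_derivative_legendre_sq_le n j
  rw [mul_div_assoc]
  refine l2norm_le_of_sq_le (memLp_poly _) (by positivity)
    (commutatorBound_nonneg (by omega)) ?_
  simp only [eval_mul, eval_C, mul_pow]
  rw [integral_const_mul]
  calc (legendreCoeff (g 0) m / 2) ^ 2 *
        ∫ x, (derivative^[j + 1] (legendre n)).eval x ^ 2 ∂muOmega
      ≤ (legendreCoeff (g 0) m / 2) ^ 2 * (2 * endVal p j * endVal p (j + 1)) := by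
        refine mul_le_mul_of_nonneg_left (hL.trans ?_) (sq_nonneg _)
        have h1 := hend j (by omega)
        have h2 := hend (j + 1) (by omega)
        gcongr
    _ = legendreCoeff (g 0) m ^ 2 * (2 * endVal p j * endVal p (j + 1)) / 4 := by ring
    _ ≤ (1 / p * factRatio p (s + j) * l2norm (g (s + j)) ^ 2) *
        (2 * endVal p j * endVal p (j + 1)) / 4 := by gcongr
    _ = _ := by rw [commutatorBound]; ring

/-- The truncation error in the seminorm of order `j + 1`: `j + 1` commutators and one truncation
error in `L²(Ω)`, each at most `√(commutatorBound p s j)` times the norm of the last derivative. -/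
theorem SobolevChain.l2norm_sub_iterate_derivative_legendreSum_le {s : ℕ} (hs : 0 < s) (j : ℕ) :
    ∀ (p : ℕ) (f : ℕ → ℝ → ℝ), s + j + 1 < p → SobolevChain (s + j + 1) f →
      l2norm (fun x => f (j + 1) x -
        (derivative^[j + 1] (legendreSum (Finset.range (p + 1)) (f 0))).eval x) ≤
      (j + 2) * √(commutatorBound p s j) * l2norm (f (s + j + 1)) := by
  -- One step of the recursion, given a bound for the truncation error of the derivative `f 1`.
  have step : ∀ (j q : ℕ) (f : ℕ → ℝ → ℝ), s + j < q → SobolevChain (s + j + 1) f →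
      ∀ B, l2norm (fun x => f (j + 1) x -
        (derivative^[j] (legendreSum (Finset.range (q + 1)) (f 1))).eval x) ≤ B →
      l2norm (fun x => f (j + 1) x -
        (derivative^[j + 1] (legendreSum (Finset.range (q + 2)) (f 0))).eval x) ≤
      B + √(commutatorBound (q + 1) s j) * l2norm (f (s + j + 1)) := by
    intro j q f hq hf B hB
    have hg : SobolevChain (s + j) fun i => f (i + 1) := hf.shift
    have t1 := hg.l2norm_commutator_le (p := q + 1) (m := q + 1) (n := q) (by omega) (by omega)
      (by omega) (by omega) (by omega)
    have t2 := hg.l2norm_commutator_le (p := q + 1) (m := q + 2) (n := q + 1) (by omega) (by omega)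
      (by omega) (by omega) (by omega)
    have m0 : MemLp (fun x => f (j + 1) x -
        (derivative^[j] (legendreSum (Finset.range (q + 1)) (f 1))).eval x) 2 muOmega :=
      (hf.memLp (by omega)).sub (memLp_poly _)
    have hd := (hf.1 0 (by omega)).derivative_legendreSum q
    have e : ∀ x, f (j + 1) x -
          (derivative^[j + 1] (legendreSum (Finset.range (q + 2)) (f 0))).eval x =
        (f (j + 1) x - (derivative^[j] (legendreSum (Finset.range (q + 1)) (f 1))).eval x) +
        ((C (legendreCoeff (f 1) (q + 1) / 2) * derivative^[j + 1] (legendre q)).eval x +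
          (C (legendreCoeff (f 1) (q + 2) / 2) * derivative^[j + 1] (legendre (q + 1))).eval x) := by
      intro x
      rw [Function.iterate_succ_apply, hd, iterate_derivative_sub, iterate_map_add,
        iterate_derivative_C_mul, iterate_derivative_C_mul, ← Function.iterate_succ_apply,
        ← Function.iterate_succ_apply]
      simp only [eval_sub, eval_add]
      ring
    simp only [e]
    have k1 := l2norm_add_le m0 ((memLp_poly (C (legendreCoeff (f 1) (q + 1) / 2) *
      derivative^[j + 1] (legendre q))).add (memLp_poly (C (legendreCoeff (f 1) (q + 2) / 2) *
      derivative^[j + 1] (legendre (q + 1)))))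
    have k2 := l2norm_add_le (memLp_poly (C (legendreCoeff (f 1) (q + 1) / 2) *
      derivative^[j + 1] (legendre q))) (memLp_poly (C (legendreCoeff (f 1) (q + 2) / 2) *
      derivative^[j + 1] (legendre (q + 1))))
    simp only [zero_add] at t1 t2
    refine k1.trans ?_
    have k3 := k2.trans (add_le_add t1 t2)
    rw [add_halves] at k3
    exact add_le_add hB k3
  induction j with
  | zero =>
    intro p f hp hf
    obtain ⟨q, rfl⟩ : ∃ q, p = q + 1 := ⟨p - 1, by omega⟩
    have hg : SobolevChain s fun i => f (i + 1) := hf.shift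
    have ht := hg.integral_sub_legendreSum_sq_le hs (n := q) (by omega)
    rw [← l2norm_sq hg.2] at ht
    have h1 := l2norm_le_of_sq_le (u := fun x => f (0 + 1) x -
        (legendreSum (Finset.range (q + 1)) (f (0 + 1))).eval x)
      ((hf.memLp (by omega)).sub (memLp_poly _)) (l2norm_nonneg _) (factRatio_pos _ _).le ht
    have hc : factRatio (q + 1) s ≤ commutatorBound (q + 1) s 0 := by
      have e : commutatorBound (q + 1) s 0 = (q + 2) * factRatio (q + 1) s := by
        simp [commutatorBound, endVal]
        field_simp
        ring
      rw [e]
      exact le_mul_of_one_le_left (factRatio_pos _ _).le (by linarith [q.cast_nonneg (α := ℝ)])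
    refine (step 0 q f (by omega) hf _ h1).trans ?_
    have h2 := mul_le_mul_of_nonneg_right (Real.sqrt_le_sqrt hc) (l2norm_nonneg (f (s + 1)))
    simp only [Nat.cast_zero, add_zero] at h2 ⊢
    linarith
  | succ j ih =>
    intro p f hp hf
    obtain ⟨q, rfl⟩ : ∃ q, p = q + 1 := ⟨p - 1, by omega⟩
    have hg : SobolevChain (s + j + 1) fun i => f (i + 1) := SobolevChain.shift (a := 1) hf
    have h1 := ih q _ (by omega) hg
    refine (step (j + 1) q f (by omega) hf _ h1).trans ?_
    have h2 := mul_le_mul_of_nonneg_right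
      (Real.sqrt_le_sqrt (commutatorBound_le_succ hs (show s + j + 1 < q by omega)))
      (l2norm_nonneg (f (s + j + 1 + 1)))
    have h3 := mul_le_mul_of_nonneg_left h2 (show (0 : ℝ) ≤ j + 2 by positivity)
    rw [← add_assoc s j 1]
    push_cast
    linarith

end L2Projection

open L2Projection in
theorem mainTheorem2 :
    ∃ C : ℝ, 0 < C ∧
      ∀ p k s ν : ℕ, 2 * k ≤ p + 1 → 1 ≤ ν → ν ≤ p → 0 < s → s < k → s + ν < p →
        ∀ w : ℝ → ℝ, L2Projection.MemH (k + s) w →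
          L2Projection.semiH ν (fun x => w x - (L2Projection.l2Proj p w).eval x) ^ 2 ≤
            ENNReal.ofReal (C * (2 : ℝ) ^ (2 * ν - 1) * (p : ℝ) ^ (2 * ν - 1) *
                ((Nat.factorial (p - s) : ℝ) / (Nat.factorial (p + s) : ℝ))) *
              L2Projection.semiH (s + ν) w ^ 2 := by
  refine ⟨4, by norm_num, fun p k s ν hk hν1 _ hs hsk hsν w hw => ?_⟩
  obtain ⟨j, rfl⟩ : ∃ j, ν = j + 1 := ⟨ν - 1, by omega⟩
  have hp : (0 : ℝ) < p := by exact_mod_cast (show 0 < p by omega)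
  -- For `ν > k` the right-hand side may be infinite.
  by_cases htop : semiH (s + (j + 1)) w = ⊤
  · rw [htop, ENNReal.top_pow two_ne_zero, ENNReal.mul_top]
    · exact le_top
    · exact (ENNReal.ofReal_pos.2 (by positivity)).ne'
  obtain ⟨g, hwg, hg⟩ : ∃ g, IsWeakDeriv (s + (j + 1)) w g ∧ MemLp g 2 muOmega := by
    have h1 := lt_top_iff_ne_top.2 htop
    simp only [semiH, iInf_lt_iff] at h1
    obtain ⟨g, hwg, hlt⟩ := h1
    exact ⟨g, hwg, hwg.2.1.aestronglyMeasurable, hlt⟩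
  obtain ⟨f, hf, hwf⟩ := hwg.exists_sobolevChain hw.1 hg
  rw [← add_assoc] at hf
  set S := legendreSum (Finset.range (p + 1)) (f 0) with hS
  have hproj : l2Proj p w = S := by
    rw [l2Proj_eq_legendreSum p hw.1, hS]
    refine Finset.sum_congr rfl fun m _ => ?_
    have : legendreCoeff w m = legendreCoeff (f 0) m := by
      refine integral_congr_ae ?_
      filter_upwards [hwf] with x hx
      rw [hx]
    rw [this]
  have hd := hf.add (sobolevChain_poly _ (-S))
  have hwd : (fun x => w x - S.eval x) =ᵐ[muOmega]
      fun x => f 0 x + (derivative^[0] (-S)).eval x := by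
    filter_upwards [hwf] with x hx
    rw [hx]
    simp [sub_eq_add_neg]
  have hmem : MemLp (fun x => f (j + 1) x - (derivative^[j + 1] S).eval x) 2 muOmega :=
    (hf.memLp (by omega)).sub (memLp_poly _)
  have hl : semiH (j + 1) (fun x => w x - S.eval x) =
      ENNReal.ofReal (l2norm fun x => f (j + 1) x - (derivative^[j + 1] S).eval x) := by
    rw [semiH_eq (hd.isWeakDeriv hwd (show j + 1 ≤ s + j + 1 by omega)), ofReal_l2norm hmem]
    simp only [iterate_derivative_neg, eval_neg, ← sub_eq_add_neg]
  have hr : semiH (s + (j + 1)) w = ENNReal.ofReal (l2norm (f (s + j + 1))) := by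
    rw [ofReal_l2norm hf.2, ← semiH_eq (hf.isWeakDeriv hwf le_rfl), add_assoc]
  rw [hproj, hl, hr, ← ENNReal.ofReal_pow (l2norm_nonneg _), ← ENNReal.ofReal_pow (l2norm_nonneg _),
    ← ENNReal.ofReal_mul (by positivity)]
  refine ENNReal.ofReal_le_ofReal ?_
  have hmain := SobolevChain.l2norm_sub_iterate_derivative_legendreSum_le hs j p f (by omega) hf
  have hG := commutatorBound_nonneg (s := s) (show j < p by omega)
  have hbound := four_pow_mul_commutatorBound_le hs (show 2 * s + 1 ≤ p by omega)
    (show s + j + 1 < p by omega)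
  have hj : (j + 2 : ℝ) ≤ 2 * 2 ^ j := by
    have : j + 2 ≤ 2 ^ (j + 1) := Nat.lt_two_pow_self (n := j + 1)
    rw [pow_succ'] at this
    exact_mod_cast this
  calc (l2norm fun x => f (j + 1) x - (derivative^[j + 1] S).eval x) ^ 2
      ≤ ((j + 2) * √(commutatorBound p s j) * l2norm (f (s + j + 1))) ^ 2 :=
        pow_le_pow_left₀ (l2norm_nonneg _) hmain 2
    _ = (j + 2) ^ 2 * commutatorBound p s j * l2norm (f (s + j + 1)) ^ 2 := by
        rw [mul_pow, mul_pow, Real.sq_sqrt hG]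
    _ ≤ (2 * 2 ^ j) ^ 2 * commutatorBound p s j * l2norm (f (s + j + 1)) ^ 2 := by gcongr
    _ = 4 * (4 ^ j * commutatorBound p s j) * l2norm (f (s + j + 1)) ^ 2 := by
        have h4 : ((2 : ℝ) ^ j) ^ 2 = 4 ^ j := by rw [← pow_mul, mul_comm, pow_mul]; norm_num
        rw [mul_pow, h4]; ring
    _ ≤ 4 * ((2 * p) ^ (2 * j + 1) * factRatio p s) * l2norm (f (s + j + 1)) ^ 2 := by gcongr
    _ = _ := by
        rw [show 2 * (j + 1) - 1 = 2 * j + 1 by omega, mul_pow, factRatio]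
        ring
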